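/- Fix $d\ge 1$, a symmetric positive definite matrix $A\in\mathbb{R}^{d\times d}$, $\sigma>0$, and write $\|u\|_M=\sqrt{u^\top M u}$ and $\overline{\log}(x)=1+\log(\max(x,1))$. The action set is the centered ellipsoid $\mathcal X=\{x\in\mathbb{R}^d:\|x\|_{A^{-1}}\le 1\}$. In each of the rounds $t=0,1,\dots,T-1$ a learner plays $x_t\in\mathcal X$, chosen from the rewards of the previous rounds, and receives $y_t=x_t^\top\theta+z_t$, where $\theta\in\mathbb{R}^d$ is unknown to the learner and the $z_t$ are independent, centered and subgaussian with variance proxy $\sigma^2$, i.e. $\mathbb{E}[e^{\lambda z_t}]\le e^{\lambda^2\sigma^2/2}$ for all $\lambda\in\mathbb{R}$. For each $u\in\mathbb{R}^d$ let $x^\star(u)$ be an element of $\arg\max_{x\in\mathcal X}x^\top u$. The regret is $R_T(\theta)=\mathbb{E}\big[\sum_{t=0}^{T-1}(x^\star(\theta)-x_t)^\top\theta\big]$. The algorithm E2TC with parameter $\alpha\ge 0$ is the following. For $i\ge 1$ put $n_i=d2^{i-1}$, $T_i=d(2^i-1)$, $T_0=0$, $\delta_i=\min(dn_i/T,1)$,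 and let $U(\delta,n)\ge 0$ be given by $$U(\delta,n)^2=\frac{\sigma^2d^2}{n}\Big(1+2\sqrt{\tfrac1d\log\tfrac1\delta}+\tfrac2d\log\tfrac1\delta\Big).$$ (1) Warm-up: play the round-robin actions $x_t=A^{1/2}e_{(t\bmod d)+1}$. For $i=1,2,\dots$, at the end of the $i$-th subphase $t\in[T_{i-1},T_i-1]$ (of length $n_i$), compute the ordinary least-squares estimate $\hat\theta_i$ of $\theta$ from the rounds of that subphase, and leave the warm-up at the first $i$ with $\|\hat\theta_i\|_A>\alpha\,U(\delta_i,n_i)$. (2) Exploration: with this $i$, set $\hat B=\|\hat\theta_i\|_A$ and $N_e=d\lceil\sigma\sqrt T/\hat B\rceil$, and play $x_t=A^{1/2}e_{(t\bmod d)+1}$ for $T_i\le t<T_i+N_e$. (3) Commit: let $\hat\theta$ be the ordinary least-squares estimate from the rounds $T_i\le t<T_i+N_e$, and play $x_t=x^\star(\hat\theta)$ in all later rounds. The algorithm is interrupted when the $T$ rounds are over, in whichever phase it is. Theorem. The regret of E2TC tuned with $\alpha=3$ satisfies, for every $\theta\in\mathbb{R}^d$ and every integer $T\ge 0$, $$R_T(\theta)\le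 6d\sigma\sqrt T+\frac{984\,\sigma^2d^2}{\|\theta\|_A}\,\overline{\log}\Big(\frac{T\|\theta\|_A^2}{\sigma^2d^2}\Big)+290\,d\,\|\theta\|_A+2T\|\theta\|_A\,e^{\left(2d/3-(2/9)\sqrt T\|\theta\|_A/\sigma\right)^-},$$ where $x^-=\min(x,0)$, and where for $\theta=0$ the second term is read as $0$. -/

import Mathlib

open MeasureTheory ProbabilityTheory
open scoped Matrix MatrixOrder NNReal

namespace LinBandit

noncomputable section

/-- The norm `‖u‖_M = √(uᵀ M u)` associated with a positive definite matrix `M`. -/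
def wnorm {d : ℕ} (M : Matrix (Fin d) (Fin d) ℝ) (u : Fin d → ℝ) : ℝ :=
  Real.sqrt (u ⬝ᵥ M *ᵥ u)

/-- The centered ellipsoid `{x : ‖x‖_{A⁻¹} ≤ 1}`. -/
def ellipsoid {d : ℕ} (A : Matrix (Fin d) (Fin d) ℝ) : Set (Fin d → ℝ) :=
  {x | wnorm A⁻¹ x ≤ 1}

/-- `xs` is a choice of optimal actions: `xs u ∈ argmax_{x ∈ X} xᵀ u` for every `u`. -/
def IsArgmax {d : ℕ} (X : Set (Fin d → ℝ)) (xs : (Fin d → ℝ) → Fin d → ℝ) : Prop :=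
  ∀ u, xs u ∈ X ∧ ∀ x ∈ X, x ⬝ᵥ u ≤ xs u ⬝ᵥ u

/-- `1 + log (max x 1)`. -/
def logBar (x : ℝ) : ℝ := 1 + Real.log (max x 1)

/-! ### Interaction of a learner with a linear bandit -/

/-- A (deterministic) learner: it chooses the action of round `t` (rounds are numbered from `0`)
from the `t` rewards observed in the rounds before `t`. -/
def Policy (d : ℕ) : Type := (t : ℕ) → (Fin t → ℝ) → (Fin d → ℝ)

/-- The rewards `y_s = x_sᵀ θ + z_s` of the rounds `s < t`, when the learner `π` plays against
the parameter `θ` and the noise sequence `z`. -/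
def rewards {d : ℕ} (π : Policy d) (θ : Fin d → ℝ) (z : ℕ → ℝ) : (t : ℕ) → Fin t → ℝ
  | 0 => Fin.elim0
  | t + 1 => Fin.snoc (α := fun _ => ℝ) (rewards π θ z t) (π t (rewards π θ z t) ⬝ᵥ θ + z t)

/-- The action played by `π` in round `t`. -/
def action {d : ℕ} (π : Policy d) (θ : Fin d → ℝ) (z : ℕ → ℝ) (t : ℕ) : Fin d → ℝ :=
  π t (rewards π θ z t)

/-- The random (pseudo-)regret `∑_{t < T} (x⋆(θ)ᵀ θ - x_tᵀ θ)` along a noise sequence `z`;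
the regret is its expectation. -/
def pathRegret {d : ℕ} (xs : (Fin d → ℝ) → Fin d → ℝ) (π : Policy d) (θ : Fin d → ℝ) (T : ℕ)
    (z : ℕ → ℝ) : ℝ :=
  ∑ t ∈ Finset.range T, (xs θ ⬝ᵥ θ - action π θ z t ⬝ᵥ θ)

/-! ### Least squares -/

/-- The ordinary least-squares estimate `(Xᵀ X)⁻¹ Xᵀ Y`. -/
def leastSquares {ι : Type*} [Fintype ι] {d : ℕ} (X : Matrix ι (Fin d) ℝ) (Y : ι → ℝ) :
    Fin d → ℝ :=
  (Xᵀ * X)⁻¹ *ᵥ (Xᵀ *ᵥ Y)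

/-- Least-squares estimate from the actions `x t` and rewards `y t` of the rounds `t ∈ S`. -/
def lsOn {d : ℕ} (S : Finset ℕ) (x : ℕ → Fin d → ℝ) (y : ℕ → ℝ) : Fin d → ℝ :=
  leastSquares (Matrix.of fun t : S => x t) (fun t : S => y t)

/-! ### The algorithm E2TC -/

/-- The `t`-th round-robin exploration action `A^{1/2} e_{(t mod d) + 1}`. Coordinates are
indexed by `Fin d`, from `0`. -/
def explore {d : ℕ} (A : Matrix (Fin d) (Fin d) ℝ) (t : ℕ) : Fin d → ℝ :=
  CFC.sqrt A *ᵥ fun j : Fin d => if (j : ℕ) = t % d then 1 else 0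

/-- `T_i = d (2^i - 1)`, the number of rounds in the first `i` warm-up subphases. -/
def epochEnd (d i : ℕ) : ℕ := d * (2 ^ i - 1)

/-- `n_i = d 2^(i-1)`, the length of the `i`-th warm-up subphase (`i ≥ 1`). -/
def epochLen (d i : ℕ) : ℝ := d * 2 ^ i / 2

/-- `δ_i = min (d n_i / T) 1`. -/
def delta (d T i : ℕ) : ℝ := min (d * epochLen d i / T) 1

/-- `U(δ, n)`, with `U(δ, n)² = (σ² d² / n) (1 + 2 √(log(1/δ) / d) + (2 / d) log(1/δ))`. -/
def threshold (d : ℕ) (σ δ n : ℝ) : ℝ :=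
  Real.sqrt (σ ^ 2 * d ^ 2 / n *
    (1 + 2 * Real.sqrt (1 / d * Real.log (1 / δ)) + 2 / d * Real.log (1 / δ)))

/-- Least-squares estimate from the `i`-th warm-up subphase `[T_{i-1}, T_i - 1]` (`i ≥ 1`), when
the rewards are `y`. -/
def warmEstimate {d : ℕ} (A : Matrix (Fin d) (Fin d) ℝ) (y : ℕ → ℝ) (i : ℕ) : Fin d → ℝ :=
  lsOn (Finset.Ico (epochEnd d (i - 1)) (epochEnd d i)) (explore A) y

/-- The exit criterion of the warm-up, evaluated at the end of the `i`-th subphase. -/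
def ExitAt {d : ℕ} (A : Matrix (Fin d) (Fin d) ℝ) (σ α : ℝ) (T : ℕ) (y : ℕ → ℝ) (i : ℕ) : Prop :=
  1 ≤ i ∧ α * threshold d σ (delta d T i) (epochLen d i) < wnorm A (warmEstimate A y i)

/-- The length `N_e = d ⌈σ √T / B⌉` of the exploration phase, for a norm estimate `B`. -/
def exploreLen (d : ℕ) (σ : ℝ) (T : ℕ) (B : ℝ) : ℕ := d * ⌈σ * Real.sqrt T / B⌉₊

open Classical in
/-- The algorithm E2TC for the centered ellipsoid of `A`, with noise level `σ`, horizon `T` and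
parameter `α`, using `xs` to select the greedy action. In round `t`, if no warm-up subphase
completed so far met the exit criterion, the algorithm is in the warm-up phase and plays
round-robin. Otherwise let `i` be the first one that did: the algorithm continues round-robin for
`N_e` rounds, then commits to the greedy action for the least-squares estimate based on these
`N_e` rounds. -/
def e2tc {d : ℕ} (A : Matrix (Fin d) (Fin d) ℝ) (xs : (Fin d → ℝ) → Fin d → ℝ)
    (σ α : ℝ) (T : ℕ) : Policy d := fun t past =>
  -- rewards observed so far; entries from round `t` on are never read
  let y : ℕ → ℝ := fun s => if hs : s < t then past ⟨s, hs⟩ else 0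
  if h : ∃ i, epochEnd d i ≤ t ∧ ExitAt A σ α T y i then
    let i := Nat.find h
    let Ne := exploreLen d σ T (wnorm A (warmEstimate A y i))
    if t < epochEnd d i + Ne then explore A t
    else xs (lsOn (Finset.Ico (epochEnd d i) (epochEnd d i + Ne)) (explore A) y)
  else explore A t

end

end LinBandit

/-! Multiplying by `A^{1/2}` turns the ellipsoid into the Euclidean unit ball, `θ` into `v = whiten
A θ`, and the least-squares estimate from `m` full round-robin passes into `v` plus the
coordinatewise noise means `blockNoise` (`whiten_lsOn`). With `b = ‖v‖`, a round costs at most `2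
b`, while the greedy action for an estimate `p` costs at most `(2 / b) ‖p - v‖²`
(`norm_sub_inner_div_le`). If the norm estimate `B` is within a factor `5/2` of `b`, exploring about
`σ √T / B` passes balances exploration against commitment, at total cost of order `d σ √T`
(`explore_commit_tradeoff`).

What remains is the price of the warm-up and of a bad `B`. Let `i₀` be a subphase with `4 U_{i₀} ≤
b`. Up to `i₀`, a bad exit forces noise at least `(9/5) U_i`; this has probability at most a
constant times `δ_i / d`, and since `T δ_i ≤ d n_i` its cost is at most a multiple of `b n_i`, a
geometric sum. After `i₀`, a failure to exit or a bad exit forces noise at least `0.465 b`, whose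
probability falls fast enough to beat the doubling lengths. Both kinds of failure thus cost a
constant times `b n_{i₀}` (`sum_early_exit_le`, `sum_late_exit_le`), as does the warm-up through
subphase `i₀ + 1`. For the least admissible `i₀`, the failed test at `i₀ - 1` gives `n_{i₀} ≤ d +
O((σ d / b)² logBar(T b² / (σ d)²))` (`exists_detection_epoch`).

Two facts make this rigorous. The path coincides with pure round-robin until commitment, so exit
events can be read off the raw noise (`action_e2tc`). The exit and the value of `m` depend on rounds
before the exploration starts, hence are independent of the noise that drives the final estimate
(`integral_exitEvent_le`). -/

namespace LinBandit

/-! ### Whitening, and the quadratic regret of the greedy action -/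

section LinearAlgebra

variable {d : ℕ} {A : Matrix (Fin d) (Fin d) ℝ}

/-- The Euclidean vector `A^{1/2} u`. -/
noncomputable def whiten (A : Matrix (Fin d) (Fin d) ℝ) (u : Fin d → ℝ) : EuclideanSpace ℝ (Fin d) :=
  WithLp.toLp 2 (CFC.sqrt A *ᵥ u)

theorem sqrt_mul_sqrt (hA : A.PosDef) : CFC.sqrt A * CFC.sqrt A = A :=
  CFC.sqrt_mul_sqrt_self A hA.posSemidef.nonneg

theorem transpose_sqrt (A : Matrix (Fin d) (Fin d) ℝ) : (CFC.sqrt A)ᵀ = CFC.sqrt A := by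
  have h := (Matrix.nonneg_iff_posSemidef.1 (CFC.sqrt_nonneg A)).1
  rw [Matrix.IsHermitian, Matrix.conjTranspose_eq_transpose_of_trivial] at h
  exact h

theorem isUnit_det_sqrt (hA : A.PosDef) : IsUnit (CFC.sqrt A).det := by
  have h := congrArg Matrix.det (sqrt_mul_sqrt hA)
  rw [Matrix.det_mul] at h
  have h2 := hA.det_pos
  rw [isUnit_iff_ne_zero]
  intro h0
  rw [h0] at h
  simp at h
  exact h2.ne h

theorem sqrt_mulVec_dotProduct (A : Matrix (Fin d) (Fin d) ℝ) (u w : Fin d → ℝ) :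
    (CFC.sqrt A *ᵥ u) ⬝ᵥ w = u ⬝ᵥ (CFC.sqrt A *ᵥ w) := by
  rw [Matrix.dotProduct_mulVec, ← Matrix.mulVec_transpose, transpose_sqrt]

theorem inner_toLp (u w : Fin d → ℝ) :
    inner ℝ (WithLp.toLp 2 u : EuclideanSpace ℝ (Fin d)) (WithLp.toLp 2 w) = u ⬝ᵥ w := by
  simp [PiLp.inner_apply, dotProduct, mul_comm]

theorem norm_toLp (u : Fin d → ℝ) :
    ‖(WithLp.toLp 2 u : EuclideanSpace ℝ (Fin d))‖ = Real.sqrt (u ⬝ᵥ u) := by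
  rw [← inner_toLp, real_inner_self_eq_norm_sq, Real.sqrt_sq (norm_nonneg _)]

theorem wnorm_eq_norm_whiten (hA : A.PosDef) (u : Fin d → ℝ) : wnorm A u = ‖whiten A u‖ := by
  rw [whiten, norm_toLp, wnorm, sqrt_mulVec_dotProduct, Matrix.mulVec_mulVec, sqrt_mul_sqrt hA]

theorem wnorm_inv_sqrt_mulVec (hA : A.PosDef) (a : Fin d → ℝ) :
    wnorm A⁻¹ (CFC.sqrt A *ᵥ a) = ‖(WithLp.toLp 2 a : EuclideanSpace ℝ (Fin d))‖ := by
  have hu := isUnit_det_sqrt hA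
  rw [norm_toLp, wnorm, sqrt_mulVec_dotProduct, Matrix.mulVec_mulVec, Matrix.mulVec_mulVec]
  have : CFC.sqrt A * A⁻¹ * CFC.sqrt A = 1 := by
    nth_rw 2 [← sqrt_mul_sqrt hA]
    rw [Matrix.mul_inv_rev, Matrix.mul_assoc, Matrix.mul_assoc, Matrix.nonsing_inv_mul _ hu, Matrix.mul_one,
      Matrix.mul_nonsing_inv _ hu]
  rw [this, Matrix.one_mulVec]

theorem exists_eq_sqrt_mulVec (hA : A.PosDef) (x : Fin d → ℝ) : ∃ a, x = CFC.sqrt A *ᵥ a :=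
  ⟨(CFC.sqrt A)⁻¹ *ᵥ x, by
    rw [Matrix.mulVec_mulVec, Matrix.mul_nonsing_inv _ (isUnit_det_sqrt hA), Matrix.one_mulVec]⟩

theorem sqrt_mulVec_mem_ellipsoid (hA : A.PosDef) (a : Fin d → ℝ) :
    CFC.sqrt A *ᵥ a ∈ ellipsoid A ↔ ‖(WithLp.toLp 2 a : EuclideanSpace ℝ (Fin d))‖ ≤ 1 := by
  rw [ellipsoid, Set.mem_ofPred_eq, wnorm_inv_sqrt_mulVec hA]

theorem abs_dotProduct_le_of_mem_ellipsoid (hA : A.PosDef) {x : Fin d → ℝ} (hx : x ∈ ellipsoid A)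
    (u : Fin d → ℝ) : |x ⬝ᵥ u| ≤ ‖whiten A u‖ := by
  obtain ⟨a, rfl⟩ := exists_eq_sqrt_mulVec hA x
  rw [sqrt_mulVec_mem_ellipsoid hA] at hx
  rw [sqrt_mulVec_dotProduct, ← inner_toLp]
  exact (abs_real_inner_le_norm _ _).trans
    (mul_le_of_le_one_left (norm_nonneg _) hx)

/-- The greedy action is `A^{1/2} p / ‖p‖` with `p = A^{1/2} u`, unless `u = 0`. -/
theorem argmax_dotProduct (hA : A.PosDef) {xs : (Fin d → ℝ) → Fin d → ℝ}
    (hxs : IsArgmax (ellipsoid A) xs) (u θ : Fin d → ℝ) (hu : whiten A u ≠ 0) :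
    xs u ⬝ᵥ θ = inner ℝ (whiten A u) (whiten A θ) / ‖whiten A u‖ := by
  obtain ⟨h1, h2⟩ := hxs u
  obtain ⟨a, ha⟩ := exists_eq_sqrt_mulVec hA (xs u)
  rw [ha] at h1 h2 ⊢
  rw [sqrt_mulVec_mem_ellipsoid hA] at h1
  set p := whiten A u with hp
  have hpp : 0 < ‖p‖ := norm_pos_iff.2 hu
  have h3 := h2 (CFC.sqrt A *ᵥ (‖p‖⁻¹ • p).ofLp) (by
    rw [sqrt_mulVec_mem_ellipsoid hA]
    change ‖‖p‖⁻¹ • p‖ ≤ 1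
    rw [norm_smul, norm_inv, norm_norm, inv_mul_cancel₀ hpp.ne'])
  rw [sqrt_mulVec_dotProduct, sqrt_mulVec_dotProduct, ← inner_toLp, ← inner_toLp] at h3
  change inner ℝ (‖p‖⁻¹ • p) p ≤ inner ℝ (WithLp.toLp 2 a) p at h3
  rw [real_inner_smul_left, real_inner_self_eq_norm_sq, sq, inv_mul_cancel_left₀ hpp.ne'] at h3
  -- Equality case of Cauchy–Schwarz: `‖a‖ ≤ 1` and `⟪a, p⟫ ≥ ‖p‖` leave no room in `‖a - p/‖p‖‖² ≥
  -- 0`.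
  have h4 : WithLp.toLp 2 a = ‖p‖⁻¹ • p := by
    rw [← sub_eq_zero, ← norm_eq_zero, ← sq_eq_zero_iff]
    apply le_antisymm _ (sq_nonneg _)
    rw [norm_sub_sq_real, real_inner_smul_right, norm_smul, norm_inv, norm_norm,
      inv_mul_cancel₀ hpp.ne']
    have h5 : 1 ≤ ‖p‖⁻¹ * inner ℝ (WithLp.toLp 2 a) p := by
      rw [← inv_mul_cancel₀ hpp.ne']
      exact mul_le_mul_of_nonneg_left h3 (by positivity)
    nlinarith [norm_nonneg (WithLp.toLp 2 a : EuclideanSpace ℝ (Fin d))]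
  rw [sqrt_mulVec_dotProduct, ← inner_toLp, h4, real_inner_smul_left]
  change ‖p‖⁻¹ * inner ℝ p (whiten A θ) = _
  rw [inv_mul_eq_div]

theorem argmax_self (hA : A.PosDef) {xs : (Fin d → ℝ) → Fin d → ℝ}
    (hxs : IsArgmax (ellipsoid A) xs) (θ : Fin d → ℝ) : xs θ ⬝ᵥ θ = ‖whiten A θ‖ := by
  by_cases h : whiten A θ = 0
  · have := abs_dotProduct_le_of_mem_ellipsoid hA (hxs θ).1 θ
    rw [h, norm_zero] at this ⊢
    exact abs_eq_zero.1 (le_antisymm this (abs_nonneg _))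
  · rw [argmax_dotProduct hA hxs θ θ h, real_inner_self_eq_norm_sq, sq,
      mul_div_cancel_right₀ _ (norm_ne_zero_iff.2 h)]

/-- The left side is `‖v‖ (1 - cos)` of the angle between `p` and `v`, which is of second order in
the estimation error. This quadratic gain is what makes the commit phase affordable. -/
theorem norm_sub_inner_div_le {E : Type*} [NormedAddCommGroup E] [InnerProductSpace ℝ E]
    (v p : E) (hv : v ≠ 0) (hp : p ≠ 0) :
    ‖v‖ - inner ℝ p v / ‖p‖ ≤ 2 / ‖v‖ * ‖p - v‖ ^ 2 := by
  have hv' : 0 < ‖v‖ := norm_pos_iff.2 hv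
  have hp' : 0 < ‖p‖ := norm_pos_iff.2 hp
  have h1 : ‖p - v‖ ^ 2 = ‖p‖ ^ 2 - 2 * inner ℝ p v + ‖v‖ ^ 2 := norm_sub_sq_real p v
  have h2 : |inner ℝ p v| ≤ ‖p‖ * ‖v‖ := abs_real_inner_le_norm p v
  have h3 := (abs_le.1 h2).1
  have h4 := (abs_le.1 h2).2
  rw [h1]
  set c := inner ℝ p v
  have h5 : ‖v‖ - c / ‖p‖ = (‖v‖ * (‖p‖ * ‖v‖ - c)) / (‖v‖ * ‖p‖) := by field_simp
  rw [h5, div_le_iff₀ (by positivity)]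
  have h6 : 2 / ‖v‖ * (‖p‖ ^ 2 - 2 * c + ‖v‖ ^ 2) * (‖v‖ * ‖p‖)
      = 2 * ‖p‖ * (‖p‖ ^ 2 - 2 * c + ‖v‖ ^ 2) := by field_simp
  rw [h6]
  -- Both sides are affine in `c`, so the endpoints `c = ±‖p‖ ‖v‖` of Cauchy–Schwarz decide. The
  -- slope of the difference has the sign of `‖v‖ - 4 ‖p‖`, whence the case split.
  have key : ‖v‖ * (‖p‖ * ‖v‖ - c) ≤ 2 * ‖p‖ * (‖p‖ ^ 2 - 2 * c + ‖v‖ ^ 2) := by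
    rcases le_total ‖v‖ (4 * ‖p‖) with h | h
    · nlinarith [mul_nonneg (sub_nonneg.2 h) (sub_nonneg.2 h4), mul_nonneg hp'.le (sq_nonneg (‖p‖ - ‖v‖))]
    · nlinarith [mul_nonneg (sub_nonneg.2 h) (sub_nonneg.2 h4),
        mul_nonneg (sub_nonneg.2 h) (by linarith : 0 ≤ c + ‖p‖ * ‖v‖),
        mul_nonneg hp'.le (sq_nonneg (‖p‖ - ‖v‖)), mul_nonneg hp'.le hv'.le,
        mul_nonneg hp'.le (mul_nonneg hp'.le hv'.le)]
  exact key

theorem regret_argmax_le (hA : A.PosDef) {xs : (Fin d → ℝ) → Fin d → ℝ}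
    (hxs : IsArgmax (ellipsoid A) xs) (u θ : Fin d → ℝ) (hθ : whiten A θ ≠ 0) :
    ‖whiten A θ‖ - xs u ⬝ᵥ θ ≤ 2 / ‖whiten A θ‖ * ‖whiten A u - whiten A θ‖ ^ 2 := by
  by_cases h : whiten A u = 0
  · have h1 := abs_dotProduct_le_of_mem_ellipsoid hA (hxs u).1 θ
    have h2 := (abs_le.1 h1).1
    have h3 : 0 < ‖whiten A θ‖ := norm_pos_iff.2 hθ
    rw [h, zero_sub, norm_neg]
    have : 2 / ‖whiten A θ‖ * ‖whiten A θ‖ ^ 2 = 2 * ‖whiten A θ‖ := by field_simp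
    linarith
  · rw [argmax_dotProduct hA hxs u θ h]
    exact norm_sub_inner_div_le _ _ hθ h

theorem explore_mem_ellipsoid (hA : A.PosDef) (t : ℕ) : explore A t ∈ ellipsoid A := by
  rw [explore, sqrt_mulVec_mem_ellipsoid hA, norm_toLp]
  rw [Real.sqrt_le_one]
  simp only [dotProduct, mul_ite, mul_one, mul_zero]
  calc ∑ j : Fin d, (if (j : ℕ) = t % d then if (j : ℕ) = t % d then (1 : ℝ) else 0 else 0)
      = ∑ j ∈ Finset.univ.filter (fun j : Fin d => (j : ℕ) = t % d), (1 : ℝ) := by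
        rw [Finset.sum_filter]; exact Finset.sum_congr rfl fun j _ => by split_ifs <;> rfl
    _ ≤ 1 := by
        rw [Finset.sum_const, nsmul_eq_mul, mul_one]
        exact_mod_cast Finset.card_le_one.2 fun a ha b hb => by
          simp only [Finset.mem_filter] at ha hb
          exact Fin.ext (ha.2.trans hb.2.symm)

end LinearAlgebra

/-! ### Least squares over complete round-robin passes -/

section LeastSquares

variable {d : ℕ} {A : Matrix (Fin d) (Fin d) ℝ}

theorem sum_Ico_mul_eq {M : Type*} [AddCommMonoid M] (d q m : ℕ) (f : ℕ → M) :
    ∑ t ∈ Finset.Ico (d * q) (d * (q + m)), f t =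
      ∑ k ∈ Finset.Ico q (q + m), ∑ j : Fin d, f (d * k + j) := by
  induction m with
  | zero => simp
  | succ m ih =>
    rw [← add_assoc, Finset.sum_Ico_succ_top (by omega), ← ih,
      ← Finset.sum_Ico_consecutive f (Nat.mul_le_mul_left d (by omega : q ≤ q + m))
        (Nat.mul_le_mul_left d (by omega : q + m ≤ q + m + 1))]
    congr 1
    rw [Finset.sum_Ico_eq_sum_range, Nat.mul_succ,
      Nat.add_sub_cancel_left, Finset.sum_range]

/-- Coordinatewise means of a noise sequence over `m` consecutive round-robin passes. -/
noncomputable def blockNoise (d : ℕ) (z : ℕ → ℝ) (q m : ℕ) : EuclideanSpace ℝ (Fin d) :=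
  WithLp.toLp 2 fun j => (∑ k ∈ Finset.Ico q (q + m), z (d * k + j)) / m

theorem lsOn_eq {S : Finset ℕ} (x : ℕ → Fin d → ℝ) (y : ℕ → ℝ) :
    lsOn S x y = (∑ t ∈ S, Matrix.vecMulVec (x t) (x t))⁻¹ *ᵥ ∑ t ∈ S, y t • x t := by
  unfold lsOn leastSquares
  congr 2
  · ext i j
    simp only [Matrix.mul_apply, Matrix.transpose_apply, Matrix.of_apply, Matrix.sum_apply,
      Matrix.vecMulVec_apply]
    rw [Finset.sum_coe_sort S (fun t => x t i * x t j)]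
  · ext i
    simp only [Matrix.mulVec, dotProduct, Matrix.transpose_apply, Matrix.of_apply,
      Finset.sum_apply, Pi.smul_apply, smul_eq_mul]
    rw [Finset.sum_coe_sort S (fun t => x t i * y t)]
    exact Finset.sum_congr rfl fun t _ => mul_comm _ _

theorem lsOn_congr {S : Finset ℕ} (x : ℕ → Fin d → ℝ) {y y' : ℕ → ℝ} (h : ∀ t ∈ S, y t = y' t) :
    lsOn S x y = lsOn S x y' := by
  rw [lsOn_eq, lsOn_eq]
  congr 1
  exact Finset.sum_congr rfl fun t ht => by rw [h t ht]

theorem explore_mul_add (A : Matrix (Fin d) (Fin d) ℝ) (k : ℕ) (j : Fin d) :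
    explore A (d * k + j) = CFC.sqrt A *ᵥ Pi.single j 1 := by
  unfold explore
  congr 1
  ext l
  rw [Nat.mul_add_mod, Nat.mod_eq_of_lt j.2]
  by_cases h : l = j
  · subst h; simp
  · simp [h, Fin.val_inj]

/-- The rewards of pure round-robin exploration. -/
noncomputable def exploreReward (A : Matrix (Fin d) (Fin d) ℝ) (θ : Fin d → ℝ) (z : ℕ → ℝ) (t : ℕ) : ℝ :=
  explore A t ⬝ᵥ θ + z t

/-- Over `m` passes the Gram matrix is exactly `m A`, because the columns of `A^{1/2}` are each
played `m` times. The estimation error is therefore isotropic after whitening. -/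
theorem whiten_lsOn (hA : A.PosDef) (θ : Fin d → ℝ) (z : ℕ → ℝ) (q : ℕ) {m : ℕ} (hm : 0 < m) :
    whiten A (lsOn (Finset.Ico (d * q) (d * (q + m))) (explore A) (exploreReward A θ z)) =
      whiten A θ + blockNoise d z q m := by
  have hm' : (m : ℝ) ≠ 0 := by positivity
  have hu := isUnit_det_sqrt hA
  set S := CFC.sqrt A with hS
  have h1 : ∑ t ∈ Finset.Ico (d * q) (d * (q + m)), Matrix.vecMulVec (explore A t) (explore A t)
      = (m : ℝ) • A := by
    rw [sum_Ico_mul_eq]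
    simp_rw [explore_mul_add]
    rw [Finset.sum_const, Nat.card_Ico, add_tsub_cancel_left, ← Nat.cast_smul_eq_nsmul ℝ]
    congr 1
    conv_rhs => rw [← sqrt_mul_sqrt hA]
    ext a b
    simp only [Matrix.sum_apply, Matrix.vecMulVec_apply, Matrix.mulVec_single_one, Matrix.mul_apply,
      Matrix.col_apply]
    refine Finset.sum_congr rfl fun j _ => ?_
    congr 1
    exact congrFun (congrFun (transpose_sqrt A).symm b) j
  have h2 : ∑ t ∈ Finset.Ico (d * q) (d * (q + m)), exploreReward A θ z t • explore A t =
      S *ᵥ ((m : ℝ) • (S *ᵥ θ + (blockNoise d z q m).ofLp)) := by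
    rw [sum_Ico_mul_eq]
    simp_rw [exploreReward, explore_mul_add]
    simp_rw [← Matrix.mulVec_smul]
    simp_rw [← Matrix.mulVec_sum]
    congr 1
    ext j
    simp only [sqrt_mulVec_dotProduct, single_one_dotProduct, Finset.sum_apply, Pi.smul_apply,
      Pi.single_apply, smul_eq_mul, mul_ite, mul_one, mul_zero, Finset.sum_ite_eq,
      Finset.mem_univ, if_true, Pi.add_apply, blockNoise]
    rw [Finset.sum_add_distrib]
    simp only [Finset.sum_const, Nat.card_Ico, add_tsub_cancel_left, nsmul_eq_mul, hS]
    field_simp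
  rw [lsOn_eq, h1, h2, whiten]
  have h3 : S *ᵥ (((m : ℝ) • A)⁻¹ *ᵥ (S *ᵥ ((m : ℝ) • (S *ᵥ θ + (blockNoise d z q m).ofLp)))) =
      S *ᵥ θ + (blockNoise d z q m).ofLp := by
    rw [Matrix.mulVec_smul, Matrix.mulVec_smul, ← Matrix.smul_mulVec]
    have : (m : ℝ) • ((m : ℝ) • A)⁻¹ = S⁻¹ * S⁻¹ := by
      rw [← Matrix.mul_inv_rev, sqrt_mul_sqrt hA]
      have hA' : IsUnit A.det := hA.isUnit.map Matrix.detMonoidHom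
      have : ((m : ℝ) • A)⁻¹ = (m : ℝ)⁻¹ • A⁻¹ := by
        apply Matrix.inv_eq_right_inv
        rw [Matrix.smul_mul, Matrix.mul_smul, Matrix.mul_nonsing_inv _ hA', smul_smul,
          mul_inv_cancel₀ hm', one_smul]
      rw [this, smul_smul, mul_inv_cancel₀ hm', one_smul]
    rw [this, Matrix.mulVec_mulVec, Matrix.mulVec_mulVec, ← Matrix.mul_assoc,
      Matrix.mul_nonsing_inv _ hu, Matrix.one_mul, Matrix.nonsing_inv_mul _ hu, Matrix.one_mulVec]
  rw [h3]
  rfl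

end LeastSquares

/-! ### The trajectory, read off the rewards of pure exploration -/

section Trajectory

variable {d : ℕ} {A : Matrix (Fin d) (Fin d) ℝ}

theorem epochEnd_mono (d : ℕ) : Monotone (epochEnd d) := fun i j h => by
  unfold epochEnd
  exact Nat.mul_le_mul_left d (Nat.sub_le_sub_right (Nat.pow_le_pow_right (by norm_num) h) 1)

theorem le_epochEnd (hd : 0 < d) (i : ℕ) : i ≤ epochEnd d i := by
  unfold epochEnd
  have h : i < 2 ^ i := Nat.lt_two_pow_self
  calc i ≤ 2 ^ i - 1 := by omega
    _ ≤ d * (2 ^ i - 1) := Nat.le_mul_of_pos_left _ hd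

theorem warmEstimate_congr {y y' : ℕ → ℝ} {i : ℕ} (h : ∀ t < epochEnd d i, y t = y' t) :
    warmEstimate A y i = warmEstimate A y' i :=
  lsOn_congr _ fun t ht => h t (Finset.mem_Ico.1 ht).2

theorem exitAt_congr {σ α : ℝ} {T : ℕ} {y y' : ℕ → ℝ} {i : ℕ}
    (h : ∀ t < epochEnd d i, y t = y' t) : ExitAt A σ α T y i ↔ ExitAt A σ α T y' i := by
  unfold ExitAt
  rw [warmEstimate_congr h]

theorem rewards_apply (π : Policy d) (θ : Fin d → ℝ) (z : ℕ → ℝ) (t s : ℕ) (hs : s < t) :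
    rewards π θ z t ⟨s, hs⟩ = action π θ z s ⬝ᵥ θ + z s := by
  induction t with
  | zero => omega
  | succ t ih =>
    rw [rewards]
    rcases Nat.lt_succ_iff_lt_or_eq.1 hs with h | h
    · have := Fin.snoc_castSucc (α := fun _ => ℝ) (π t (rewards π θ z t) ⬝ᵥ θ + z t)
        (rewards π θ z t) ⟨s, h⟩
      exact this.trans (ih h)
    · subst h
      exact Fin.snoc_last (α := fun _ => ℝ) (π s (rewards π θ z s) ⬝ᵥ θ + z s) (rewards π θ z s)

/-- `i` is the first warm-up subphase that meets the exit criterion. -/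
def FirstExit (A : Matrix (Fin d) (Fin d) ℝ) (σ α : ℝ) (T : ℕ) (y : ℕ → ℝ) (i : ℕ) : Prop :=
  ExitAt A σ α T y i ∧ ∀ j < i, ¬ ExitAt A σ α T y j

theorem firstExit_congr {σ α : ℝ} {T : ℕ} {y y' : ℕ → ℝ} {i : ℕ}
    (h : ∀ t < epochEnd d i, y t = y' t) : FirstExit A σ α T y i ↔ FirstExit A σ α T y' i := by
  unfold FirstExit
  rw [exitAt_congr h]
  refine and_congr_right fun _ => forall₂_congr fun j hj => ?_
  rw [exitAt_congr fun t ht => h t (ht.trans_le (epochEnd_mono d hj.le))]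

theorem FirstExit.unique {σ α : ℝ} {T : ℕ} {y : ℕ → ℝ} {i j : ℕ}
    (hi : FirstExit A σ α T y i) (hj : FirstExit A σ α T y j) : i = j := by
  rcases lt_trichotomy i j with h | h | h
  · exact absurd hi.1 (hj.2 i h)
  · exact h
  · exact absurd hj.1 (hi.2 j h)

theorem exists_firstExit {σ α : ℝ} {T : ℕ} {y : ℕ → ℝ} {i : ℕ} (h : ExitAt A σ α T y i) :
    ∃ j ≤ i, FirstExit A σ α T y j := by
  classical
  have h' : ∃ i, ExitAt A σ α T y i := ⟨i, h⟩
  exact ⟨Nat.find h', Nat.find_min' h' h, Nat.find_spec h', fun j hj => Nat.find_min h' hj⟩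

variable (A) (xs : (Fin d → ℝ) → Fin d → ℝ) (σ α : ℝ) (T : ℕ)

/-- The number of exploration rounds after an exit at the end of the `i`-th subphase. -/
noncomputable def exploreRounds (y : ℕ → ℝ) (i : ℕ) : ℕ :=
  exploreLen d σ T (wnorm A (warmEstimate A y i))

/-- The rewards visible to the policy in round `t`. -/
def visible {t : ℕ} (past : Fin t → ℝ) (s : ℕ) : ℝ := if hs : s < t then past ⟨s, hs⟩ else 0

theorem e2tc_of_not_exit {t : ℕ} {past : Fin t → ℝ}
    (h : ∀ i, epochEnd d i ≤ t → ¬ ExitAt A σ α T (visible past) i) :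
    e2tc A xs σ α T t past = explore A t := by
  have h' : ¬ ∃ i, epochEnd d i ≤ t ∧ ExitAt A σ α T (visible past) i := by
    rintro ⟨i, h1, h2⟩
    exact h i h1 h2
  unfold e2tc
  exact dif_neg h'

open Classical in
theorem e2tc_of_firstExit {t i : ℕ} {past : Fin t → ℝ} (hit : epochEnd d i ≤ t)
    (h : FirstExit A σ α T (visible past) i) :
    e2tc A xs σ α T t past =
      if t < epochEnd d i + exploreRounds A σ T (visible past) i then explore A t
      else xs (lsOn (Finset.Ico (epochEnd d i)
        (epochEnd d i + exploreRounds A σ T (visible past) i)) (explore A) (visible past)) := by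
  have h' : ∃ i, epochEnd d i ≤ t ∧ ExitAt A σ α T (visible past) i := ⟨i, hit, h.1⟩
  have hf : Nat.find h' = i := by
    apply le_antisymm (Nat.find_min' h' ⟨hit, h.1⟩)
    by_contra hlt
    exact h.2 _ (not_le.1 hlt) (Nat.find_spec h').2
  unfold e2tc
  refine (dif_pos h').trans ?_
  simp only [exploreRounds]
  rw [← hf]
  rfl

variable (θ : Fin d → ℝ) (z : ℕ → ℝ)

/-- The trajectory of the algorithm, in terms of the rewards of pure exploration. -/
theorem action_e2tc (t : ℕ) :
    ((∀ i, epochEnd d i ≤ t → ¬ ExitAt A σ α T (exploreReward A θ z) i) →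
      action (e2tc A xs σ α T) θ z t = explore A t) ∧
    ∀ i, epochEnd d i ≤ t → FirstExit A σ α T (exploreReward A θ z) i →
      (t < epochEnd d i + exploreRounds A σ T (exploreReward A θ z) i →
        action (e2tc A xs σ α T) θ z t = explore A t) ∧
      (epochEnd d i + exploreRounds A σ T (exploreReward A θ z) i ≤ t →
        action (e2tc A xs σ α T) θ z t = xs (lsOn (Finset.Ico (epochEnd d i)
          (epochEnd d i + exploreRounds A σ T (exploreReward A θ z) i)) (explore A)
            (exploreReward A θ z))) := by
  induction t using Nat.strong_induction_on with
  | _ t ih =>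
  set y := exploreReward A θ z with hy
  have hvis : ∀ s < t, action (e2tc A xs σ α T) θ z s = explore A s →
      visible (rewards (e2tc A xs σ α T) θ z t) s = y s := by
    intro s hs h
    rw [visible, dif_pos hs, rewards_apply, h]
    rfl
  constructor
  · intro h
    have hagree : ∀ s < t, visible (rewards (e2tc A xs σ α T) θ z t) s = y s := fun s hs =>
      hvis s hs ((ih s hs).1 fun i hi => h i (hi.trans hs.le))
    refine e2tc_of_not_exit A xs σ α T fun i hi he => h i hi ?_
    exact (exitAt_congr fun s hs => hagree s (hs.trans_le hi)).1 he
  · intro i hi hF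
    -- Every round before the commitment is round-robin: an earlier exit would, through
    -- `exists_firstExit`, yield a first exit different from `i`. So the observed rewards there are
    -- those of pure exploration.
    have hagree : ∀ s < t, s < epochEnd d i + exploreRounds A σ T y i →
        visible (rewards (e2tc A xs σ α T) θ z t) s = y s := by
      intro s hs hs'
      refine hvis s hs ?_
      by_cases hsi : epochEnd d i ≤ s
      · exact ((ih s hs).2 i hsi hF).1 hs'
      · refine (ih s hs).1 fun j hj he => ?_
        obtain ⟨k, hk, hFk⟩ := exists_firstExit he
        have := hFk.unique hF
        subst this
        exact hsi ((epochEnd_mono d hk).trans hj)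
    have hagree' : ∀ s < epochEnd d i, visible (rewards (e2tc A xs σ α T) θ z t) s = y s :=
      fun s hs => hagree s (hs.trans_le hi) (by omega)
    have hF' : FirstExit A σ α T (visible (rewards (e2tc A xs σ α T) θ z t)) i :=
      (firstExit_congr hagree').2 hF
    have hN : exploreRounds A σ T (visible (rewards (e2tc A xs σ α T) θ z t)) i =
        exploreRounds A σ T y i := by
      unfold exploreRounds
      rw [warmEstimate_congr hagree']
    have hact : action (e2tc A xs σ α T) θ z t = _ := e2tc_of_firstExit A xs σ α T hi hF'
    rw [hN] at hact
    rw [hact]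
    constructor
    · intro h
      rw [if_pos h]
    · intro h
      rw [if_neg (not_lt.2 h)]
      congr 1
      refine lsOn_congr _ fun s hs => ?_
      have := (Finset.mem_Ico.1 hs).2
      exact hagree s (this.trans_le h) this

end Trajectory

/-! ### Warm-up and exploration estimates in whitened coordinates -/

section Whitened

variable {d : ℕ} {A : Matrix (Fin d) (Fin d) ℝ}

/-- The estimation noise of the `i`-th warm-up subphase. -/
noncomputable def warmNoise (d : ℕ) (z : ℕ → ℝ) (i : ℕ) : EuclideanSpace ℝ (Fin d) :=
  blockNoise d z (2 ^ (i - 1) - 1) (2 ^ (i - 1))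

theorem wnorm_warmEstimate (hA : A.PosDef) (θ : Fin d → ℝ) (z : ℕ → ℝ) {i : ℕ} (hi : 1 ≤ i) :
    wnorm A (warmEstimate A (exploreReward A θ z) i) = ‖whiten A θ + warmNoise d z i‖ := by
  rw [wnorm_eq_norm_whiten hA, warmNoise, ← whiten_lsOn hA θ z _ (by positivity), warmEstimate]
  congr 4
  unfold epochEnd
  obtain ⟨k, rfl⟩ : ∃ k, i = k + 1 := ⟨i - 1, by omega⟩
  simp only [Nat.add_sub_cancel]
  have : 0 < 2 ^ k := by positivity
  congr 1
  omega

theorem exitAt_iff (hA : A.PosDef) (σ α : ℝ) (T : ℕ) (θ : Fin d → ℝ) (z : ℕ → ℝ) (i : ℕ) :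
    ExitAt A σ α T (exploreReward A θ z) i ↔
      1 ≤ i ∧ α * threshold d σ (delta d T i) (epochLen d i) < ‖whiten A θ + warmNoise d z i‖ :=
  and_congr_right fun hi => by rw [wnorm_warmEstimate hA θ z hi]

theorem whiten_lsOn_explore (hA : A.PosDef) (θ : Fin d → ℝ) (z : ℕ → ℝ) (i : ℕ) {m : ℕ}
    (hm : 0 < m) :
    whiten A (lsOn (Finset.Ico (epochEnd d i) (epochEnd d i + d * m)) (explore A)
      (exploreReward A θ z)) = whiten A θ + blockNoise d z (2 ^ i - 1) m := by
  rw [← whiten_lsOn hA θ z _ hm]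
  unfold epochEnd
  rw [← mul_add]

end Whitened

/-! ### Second moment and exponential square of a subgaussian variable -/

section Subgaussian

open scoped ENNReal

variable {Ω : Type*} [MeasurableSpace Ω] {μ : Measure Ω}

theorem one_add_sq_div_two_le_cosh (x : ℝ) : 1 + x ^ 2 / 2 ≤ Real.cosh x := by
  have h1 : Real.cosh x = 1 + 2 * Real.sinh (x / 2) ^ 2 := by
    have := Real.cosh_two_mul (x / 2)
    rw [mul_div_cancel₀ x two_ne_zero] at this
    rw [this, Real.cosh_sq]; ring
  have h2 : (x / 2) ^ 2 ≤ Real.sinh (x / 2) ^ 2 := by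
    rcases le_total 0 x with h | h
    · exact pow_le_pow_left₀ (by positivity) (Real.self_le_sinh_iff.2 (by positivity)) 2
    · have h3 : Real.sinh (x / 2) ≤ x / 2 := Real.sinh_le_self_iff.2 (by linarith)
      nlinarith
  rw [h1]; nlinarith

/-- Average `1 + (s X)²/2 ≤ cosh (s X)`, bound the right side by the moment generating function at
`±s`, divide by `s²/2` and let `s → 0`. -/
theorem integral_sq_le_of_subgaussian [IsProbabilityMeasure μ] {X : Ω → ℝ} {c : ℝ≥0}
    (hX : HasSubgaussianMGF X c μ) : ∫ ω, X ω ^ 2 ∂μ ≤ c := by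
  have hint : Integrable (fun ω => X ω ^ 2) μ := by
    simpa using (hX.memLp 2).integrable_sq
  have key : ∀ s : ℝ, 0 < s → ∫ ω, X ω ^ 2 ∂μ ≤ c * Real.exp (c * s ^ 2 / 2) := by
    intro s hs
    have h1 : ∫ ω, (1 + (s * X ω) ^ 2 / 2) ∂μ ≤ ∫ ω, Real.cosh (s * X ω) ∂μ := by
      refine integral_mono ?_ ?_ fun ω => one_add_sq_div_two_le_cosh _
      · simp_rw [mul_pow]
        exact (integrable_const _).add ((hint.const_mul _).div_const _)
      · simp_rw [Real.cosh_eq]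
        refine ((hX.integrable_exp_mul s).add ?_).div_const _
        simpa using hX.integrable_exp_mul (-s)
    have h2 : ∫ ω, Real.cosh (s * X ω) ∂μ ≤ Real.exp (c * s ^ 2 / 2) := by
      simp_rw [Real.cosh_eq]
      have h3 : Integrable (fun ω => Real.exp (-(s * X ω))) μ := by
        simpa using hX.integrable_exp_mul (-s)
      rw [integral_div, integral_add (hX.integrable_exp_mul s) h3]
      have h4 := hX.mgf_le s
      have h5 := hX.mgf_le (-s)
      simp only [mgf, neg_mul, neg_sq] at h4 h5
      linarith
    have h3 : ∫ ω, (1 + (s * X ω) ^ 2 / 2) ∂μ = 1 + s ^ 2 / 2 * ∫ ω, X ω ^ 2 ∂μ := by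
      simp_rw [mul_pow, mul_div_right_comm]
      rw [integral_add (integrable_const _) (hint.const_mul _), integral_const_mul]
      simp
    have h4 : Real.exp (c * s ^ 2 / 2) - 1 ≤ c * s ^ 2 / 2 * Real.exp (c * s ^ 2 / 2) := by
      have h5 := Real.add_one_le_exp (-(c * s ^ 2 / 2))
      have h6 : Real.exp (-(c * s ^ 2 / 2)) * Real.exp (c * s ^ 2 / 2) = 1 := by
        rw [← Real.exp_add]; simp
      nlinarith [Real.exp_pos (c * s ^ 2 / 2)]
    have h5 : s ^ 2 / 2 * ∫ ω, X ω ^ 2 ∂μ ≤ s ^ 2 / 2 * (c * Real.exp (c * s ^ 2 / 2)) := by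
      linarith
    exact le_of_mul_le_mul_left h5 (by positivity)
  have hlim : Filter.Tendsto (fun s : ℝ => (c : ℝ) * Real.exp (c * s ^ 2 / 2))
      (nhdsWithin 0 (Set.Ioi 0)) (nhds c) := by
    have : Continuous (fun s : ℝ => (c : ℝ) * Real.exp (c * s ^ 2 / 2)) := by fun_prop
    simpa using (this.tendsto 0).mono_left nhdsWithin_le_nhds
  exact ge_of_tendsto hlim (Filter.eventually_of_mem self_mem_nhdsWithin key)

theorem lintegral_exp_sq_gaussianReal :
    ∫⁻ g, ENNReal.ofReal (Real.exp (3 / 8 * g ^ 2)) ∂(gaussianReal 0 1) = 2 := by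
  rw [gaussianReal_of_var_ne_zero _ one_ne_zero,
    lintegral_withDensity_eq_lintegral_mul _ (measurable_gaussianPDF _ _) (by fun_prop)]
  have h : ∀ g : ℝ, (gaussianPDF 0 1 * fun g => ENNReal.ofReal (Real.exp (3 / 8 * g ^ 2))) g =
      ENNReal.ofReal ((√(2 * Real.pi))⁻¹ * Real.exp (-(1 / 8) * g ^ 2)) := by
    intro g
    rw [Pi.mul_apply, gaussianPDF, ← ENNReal.ofReal_mul (gaussianPDFReal_nonneg _ _ _),
      gaussianPDFReal, mul_assoc, ← Real.exp_add]
    simp only [NNReal.coe_one, mul_one, sub_zero]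
    congr 3
    ring
  simp_rw [h]
  rw [← ofReal_integral_eq_lintegral_ofReal]
  · rw [integral_const_mul, integral_gaussian, ← Real.sqrt_inv, ← Real.sqrt_mul (by positivity)]
    have : (2 * Real.pi)⁻¹ * (Real.pi / (1 / 8)) = 2 ^ 2 := by
      field_simp; norm_num
    rw [this, Real.sqrt_sq (by norm_num)]
    norm_num
  · exact (integrable_exp_neg_mul_sq (by norm_num)).const_mul _
  · exact Filter.Eventually.of_forall fun g => by positivity

/-- Gaussian decoupling: `exp (s² X²/2)` is the mean of `exp (s X g)` over a standard normal `g`.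
Exchanging the integrals and using the moment bound in `X` leaves the mean of `exp (3 g²/8)`, equal
to `(1 - 3/4)^{-1/2} = 2`. -/
theorem lintegral_exp_sq_le_of_subgaussian [IsProbabilityMeasure μ] {X : Ω → ℝ} (hXm : Measurable X)
    {c : ℝ≥0} (hc : 0 < c) (hX : HasSubgaussianMGF X c μ) :
    ∫⁻ ω, ENNReal.ofReal (Real.exp (3 / (8 * c) * X ω ^ 2)) ∂μ ≤ 2 := by
  have hc' : (0 : ℝ) < c := hc
  set s : ℝ := √(3 / (4 * c)) with hs
  have hs2 : s ^ 2 = 3 / (4 * c) := Real.sq_sqrt (by positivity)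
  have h1 : ∀ ω, ENNReal.ofReal (Real.exp (3 / (8 * c) * X ω ^ 2)) =
      ∫⁻ g, ENNReal.ofReal (Real.exp (s * X ω * g)) ∂(gaussianReal 0 1) := by
    intro ω
    rw [← ofReal_integral_eq_lintegral_ofReal (integrable_exp_mul_gaussianReal _)
      (Filter.Eventually.of_forall fun g => (Real.exp_pos _).le)]
    have := mgf_gaussianReal (p := gaussianReal 0 1) (X := id) (μ := 0) (v := 1) (by simp) (s * X ω)
    simp only [mgf, id] at this
    rw [this, mul_pow, hs2]
    congr 2
    simp
    field_simp
    ring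
  simp_rw [h1]
  rw [lintegral_lintegral_swap (by fun_prop)]
  calc ∫⁻ g, ∫⁻ ω, ENNReal.ofReal (Real.exp (s * X ω * g)) ∂μ ∂(gaussianReal 0 1)
      ≤ ∫⁻ g, ENNReal.ofReal (Real.exp (3 / 8 * g ^ 2)) ∂(gaussianReal 0 1) := by
        refine lintegral_mono fun g => ?_
        have h2 : ∀ ω, s * X ω * g = (s * g) * X ω := fun ω => by ring
        simp_rw [h2]
        rw [← ofReal_integral_eq_lintegral_ofReal (hX.integrable_exp_mul _)
          (Filter.Eventually.of_forall fun ω => (Real.exp_pos _).le)]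
        apply ENNReal.ofReal_le_ofReal
        refine (hX.mgf_le (s * g)).trans (Real.exp_le_exp.2 (le_of_eq ?_))
        rw [mul_pow, hs2]
        field_simp
        ring
    _ = 2 := lintegral_exp_sq_gaussianReal

end Subgaussian

/-! ### Independence over disjoint sets of rounds, and norm tails -/

section Independence

variable {Ω : Type*} {z : ℕ → Ω → ℝ}

/-- The σ-algebra generated by the noise variables with index in `S`. -/
@[reducible]
def noiseSigma (z : ℕ → Ω → ℝ) (S : Set ℕ) : MeasurableSpace Ω :=
  ⨆ t ∈ S, MeasurableSpace.comap (z t) inferInstance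

theorem measurable_noiseSigma {S : Set ℕ} {t : ℕ} (ht : t ∈ S) :
    Measurable[noiseSigma z S] (z t) := by
  rw [measurable_iff_comap_le]
  exact le_biSup (fun t => MeasurableSpace.comap (z t) (inferInstance : MeasurableSpace ℝ)) ht

variable [mΩ : MeasurableSpace Ω] {μ : Measure Ω}

theorem indepFun_of_noiseSigma (hz : ∀ t, Measurable (z t)) (hindep : iIndepFun z μ) {S S' : Set ℕ}
    (hS : Disjoint S S') {β β' : Type*} [MeasurableSpace β] [MeasurableSpace β'] {f : Ω → β}
    {g : Ω → β'} (hf : Measurable[noiseSigma z S] f) (hg : Measurable[noiseSigma z S'] g) :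
    IndepFun f g μ := by
  rw [IndepFun_iff_Indep]
  refine indep_of_indep_of_le (indep_iSup_of_disjoint (fun t => (hz t).comap_le)
    ((iIndepFun_iff_iIndep _ _ _).1 hindep) hS) ?_ ?_
  · exact measurable_iff_comap_le.1 hf
  · exact measurable_iff_comap_le.1 hg

variable {d : ℕ}

theorem measurable_blockNoise_apply {q m : ℕ} {j : Fin d}
    (hz : ∀ k ∈ Finset.Ico q (q + m), Measurable (z (d * k + j))) :
    Measurable fun ω => blockNoise d (fun t => z t ω) q m j :=
  (Finset.measurable_sum _ fun k hk => hz k hk).div_const _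

theorem measurable_blockNoise {q m : ℕ}
    (hz : ∀ t ∈ Finset.Ico (d * q) (d * (q + m)), Measurable (z t)) :
    Measurable fun ω => blockNoise d (fun t => z t ω) q m := by
  refine (PiLp.continuous_toLp 2 _).measurable.comp (measurable_pi_lambda _ fun j =>
    measurable_blockNoise_apply (j := j) fun k hk => hz _ ?_)
  have := Finset.mem_Ico.1 hk
  have hj := j.2
  rw [Finset.mem_Ico]
  constructor
  · exact le_add_right (Nat.mul_le_mul_left d this.1)
  · calc d * k + j < d * (k + 1) := by rw [mul_add_one]; omega
      _ ≤ d * (q + m) := Nat.mul_le_mul_left d this.2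

theorem hasSubgaussianMGF_blockNoise [IsProbabilityMeasure μ] (hindep : iIndepFun z μ) {c : ℝ≥0}
    (hsub : ∀ t, HasSubgaussianMGF (z t) c μ) (q : ℕ) {m : ℕ} (hm : 0 < m) (j : Fin d) :
    HasSubgaussianMGF (fun ω => blockNoise d (fun t => z t ω) q m j) (c / m) μ := by
  have hd : 0 < d := j.pos
  have hinj : Function.Injective fun k : ℕ => d * k + j := fun a b h => by
    simpa [hd.ne'] using h
  have h1 := HasSubgaussianMGF.sum_of_iIndepFun (hindep.precomp hinj)
    (s := Finset.Ico q (q + m)) (c := fun _ => c) fun k _ => hsub (d * k + j)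
  have h2 := h1.const_mul ((m : ℝ)⁻¹)
  have h3 : (⟨((m : ℝ)⁻¹) ^ 2, sq_nonneg _⟩ * ∑ _k ∈ Finset.Ico q (q + m), c : ℝ≥0) = c / m := by
    apply NNReal.coe_injective
    change ((m : ℝ)⁻¹) ^ 2 * ((∑ _k ∈ Finset.Ico q (q + m), c : ℝ≥0) : ℝ) = ((c / m : ℝ≥0) : ℝ)
    rw [Finset.sum_const, Nat.card_Ico, add_tsub_cancel_left, NNReal.coe_div,
      nsmul_eq_mul, NNReal.coe_mul, NNReal.coe_natCast]
    field_simp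
  rw [h3] at h2
  refine h2.congr (Filter.Eventually.of_forall fun ω => ?_)
  simp only [blockNoise]
  rw [div_eq_inv_mul]

theorem lintegral_exp_norm_sq_blockNoise_le [IsProbabilityMeasure μ] (hz : ∀ t, Measurable (z t))
    (hindep : iIndepFun z μ) {c : ℝ≥0} (hc : 0 < c) (hsub : ∀ t, HasSubgaussianMGF (z t) c μ)
    (q : ℕ) {m : ℕ} (hm : 0 < m) :
    ∫⁻ ω, ENNReal.ofReal (Real.exp (3 * m / (8 * c) * ‖blockNoise d (fun t => z t ω) q m‖ ^ 2)) ∂μ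
      ≤ 2 ^ d := by
  set F : Fin d → Ω → ENNReal := fun j ω =>
    ENNReal.ofReal (Real.exp (3 * m / (8 * c) * blockNoise d (fun t => z t ω) q m j ^ 2)) with hF
  let S : Finset (Fin d) → Set ℕ := fun s => {t | ∃ k, ∃ j ∈ s, t = d * k + j}
  have hFm : ∀ (s : Finset (Fin d)), ∀ j ∈ s, Measurable[noiseSigma z (S s)] (F j) := by
    intro s j hj
    have h1 : Measurable[noiseSigma z (S s)] fun ω => blockNoise d (fun t => z t ω) q m j :=
      @measurable_blockNoise_apply Ω z (noiseSigma z (S s)) d q m j fun k _ =>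
        measurable_noiseSigma ⟨k, j, hj, rfl⟩
    have h2 : Measurable fun x : ℝ => ENNReal.ofReal (Real.exp (3 * m / (8 * c) * x ^ 2)) := by
      fun_prop
    exact h2.comp h1
  have hFm' : ∀ j, Measurable (F j) := fun j => by
    have h1 : Measurable fun ω => blockNoise d (fun t => z t ω) q m j :=
      measurable_blockNoise_apply fun k _ => hz _
    exact (by fun_prop : Measurable fun x : ℝ =>
      ENNReal.ofReal (Real.exp (3 * m / (8 * c) * x ^ 2))).comp h1
  have hF2 : ∀ j, ∫⁻ ω, F j ω ∂μ ≤ 2 := by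
    intro j
    have hm' : (0 : ℝ≥0) < m := by exact_mod_cast hm
    have := lintegral_exp_sq_le_of_subgaussian (measurable_blockNoise_apply fun k _ => hz _)
      (div_pos hc hm') (hasSubgaussianMGF_blockNoise hindep hsub q hm j)
    have hcm : (3 * m / (8 * c) : ℝ) = 3 / (8 * (c / m : ℝ≥0)) := by
      have : (0 : ℝ) < c := hc
      push_cast
      field_simp
    simp only [hF, hcm]
    exact this
  -- Distinct coordinates use rounds in distinct residue classes mod `d`, hence are independent, and
  -- each contributes a factor `2`.
  have hprod : ∀ s : Finset (Fin d), ∫⁻ ω, ∏ j ∈ s, F j ω ∂μ ≤ 2 ^ s.card := by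
    intro s
    induction s using Finset.cons_induction with
    | empty => simp
    | cons i s hi ih =>
      simp only [Finset.prod_cons, Finset.card_cons]
      have hdisj : Disjoint (S {i}) (S s) := by
        rw [Set.disjoint_left]
        rintro t ⟨k, j, hj, rfl⟩ ⟨k', j', hj', h⟩
        rw [Finset.mem_singleton] at hj
        subst hj
        have h2 := congrArg (· % d) h
        simp only [Nat.mul_add_mod, Nat.mod_eq_of_lt j.2, Nat.mod_eq_of_lt j'.2] at h2
        exact hi ((Fin.ext h2) ▸ hj')
      have hgm : Measurable[noiseSigma z (S s)] fun ω => ∏ j ∈ s, F j ω :=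
        @Finset.measurable_prod _ _ _ _ _ _ (noiseSigma z (S s)) F s fun j hj => hFm s j hj
      have hind : IndepFun (F i) (fun ω => ∏ j ∈ s, F j ω) μ :=
        indepFun_of_noiseSigma hz hindep hdisj (hFm {i} i (Finset.mem_singleton_self i)) hgm
      have := lintegral_mul_eq_lintegral_mul_lintegral_of_indepFun'' (hFm' i).aemeasurable
        (Finset.measurable_prod s fun j _ => hFm' j).aemeasurable hind
      rw [this, pow_succ']
      exact mul_le_mul' (hF2 i) ih
  have h := hprod Finset.univ
  rw [Finset.card_univ, Fintype.card_fin] at h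
  refine le_trans (le_of_eq ?_) h
  refine lintegral_congr fun ω => ?_
  rw [← ENNReal.ofReal_prod_of_nonneg fun j _ => (Real.exp_pos _).le, ← Real.exp_sum,
    ← Finset.mul_sum, EuclideanSpace.norm_sq_eq]
  simp

theorem measureReal_norm_blockNoise_ge_le [IsProbabilityMeasure μ] (hz : ∀ t, Measurable (z t))
    (hindep : iIndepFun z μ) {c : ℝ≥0} (hc : 0 < c)
    (hsub : ∀ t, HasSubgaussianMGF (z t) c μ)
    (q : ℕ) {m : ℕ} (hm : 0 < m) {r : ℝ} (hr : 0 ≤ r) :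
    μ.real {ω | r ≤ ‖blockNoise d (fun t => z t ω) q m‖} ≤
      2 ^ d * Real.exp (-(3 / 8 * (m * r ^ 2 / c))) := by
  have h := lintegral_exp_norm_sq_blockNoise_le (d := d) hz hindep hc hsub q hm
  have hc' : (0 : ℝ) < c := hc
  set ε := Real.exp (3 / 8 * (m * r ^ 2 / c)) with hε
  have hW : Measurable fun ω => blockNoise d (fun t => z t ω) q m :=
    measurable_blockNoise fun t _ => hz t
  have h1 := mul_meas_ge_le_lintegral (μ := μ) (f := fun ω => ENNReal.ofReal
    (Real.exp (3 * m / (8 * c) * ‖blockNoise d (fun t => z t ω) q m‖ ^ 2))) (by fun_prop)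
    (ENNReal.ofReal ε)
  have h2 : {ω | r ≤ ‖blockNoise d (fun t => z t ω) q m‖} ⊆ {ω | ENNReal.ofReal ε ≤ ENNReal.ofReal
    (Real.exp (3 * m / (8 * c) * ‖blockNoise d (fun t => z t ω) q m‖ ^ 2))} := by
    intro ω hω
    simp only [Set.mem_ofPred_eq] at hω ⊢
    apply ENNReal.ofReal_le_ofReal
    rw [hε, Real.exp_le_exp]
    have : 3 / 8 * (m * r ^ 2 / c) = 3 * m / (8 * c) * r ^ 2 := by field_simp
    rw [this]
    gcongr
  have h3 : ENNReal.ofReal ε * μ {ω | r ≤ ‖blockNoise d (fun t => z t ω) q m‖} ≤ 2 ^ d :=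
    (mul_le_mul' le_rfl (measure_mono h2)).trans (h1.trans h)
  have h4 : ε * μ.real {ω | r ≤ ‖blockNoise d (fun t => z t ω) q m‖} ≤ 2 ^ d := by
    have := ENNReal.toReal_mono (by simp) h3
    rw [ENNReal.toReal_mul, ENNReal.toReal_ofReal (Real.exp_pos _).le] at this
    rwa [ENNReal.toReal_pow, ENNReal.toReal_ofNat] at this
  rw [Real.exp_neg, ← hε, ← div_eq_mul_inv, le_div_iff₀ (Real.exp_pos _), mul_comm]
  exact h4

theorem integrable_norm_sq_blockNoise [IsProbabilityMeasure μ]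
    (hindep : iIndepFun z μ) {c : ℝ≥0} (hsub : ∀ t, HasSubgaussianMGF (z t) c μ)
    (q : ℕ) {m : ℕ} (hm : 0 < m) :
    Integrable (fun ω => ‖blockNoise d (fun t => z t ω) q m‖ ^ 2) μ := by
  simp_rw [EuclideanSpace.norm_sq_eq, Real.norm_eq_abs, sq_abs]
  refine integrable_finsetSum _ fun j _ => ?_
  simpa using ((hasSubgaussianMGF_blockNoise hindep hsub q hm j).memLp 2).integrable_sq

theorem integral_norm_sq_blockNoise_le [IsProbabilityMeasure μ]
    (hindep : iIndepFun z μ) {c : ℝ≥0} (hsub : ∀ t, HasSubgaussianMGF (z t) c μ)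
    (q : ℕ) {m : ℕ} (hm : 0 < m) :
    ∫ ω, ‖blockNoise d (fun t => z t ω) q m‖ ^ 2 ∂μ ≤ d * (c / m) := by
  simp_rw [EuclideanSpace.norm_sq_eq, Real.norm_eq_abs, sq_abs]
  rw [integral_finsetSum _ fun j _ => by
    simpa using ((hasSubgaussianMGF_blockNoise hindep hsub q hm j).memLp 2).integrable_sq]
  calc ∑ j : Fin d, ∫ ω, blockNoise d (fun t => z t ω) q m j ^ 2 ∂μ
      ≤ ∑ _j : Fin d, ((c / m : ℝ≥0) : ℝ) := Finset.sum_le_sum fun j _ =>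
        integral_sq_le_of_subgaussian (hasSubgaussianMGF_blockNoise hindep hsub q hm j)
    _ = d * (c / m) := by simp

end Independence

/-! ### The threshold `U` and the length of the detection subphase -/

section Threshold

variable {d T : ℕ}

theorem epochLen_pos (hd : 0 < d) (i : ℕ) : 0 < epochLen d i := by
  have : (0 : ℝ) < d := by exact_mod_cast hd
  unfold epochLen; positivity

theorem epochLen_add (d i k : ℕ) : epochLen d (i + k) = 2 ^ k * epochLen d i := by
  unfold epochLen; rw [pow_add]; ring

theorem epochLen_eq {i : ℕ} (hi : 1 ≤ i) : epochLen d i = d * 2 ^ (i - 1) := by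
  obtain ⟨k, rfl⟩ : ∃ k, i = k + 1 := ⟨i - 1, by omega⟩
  simp only [Nat.add_sub_cancel]
  unfold epochLen; rw [pow_succ]; ring

theorem sum_epochLen (d N : ℕ) : ∑ i ∈ Finset.range N, epochLen d (i + 1) = d * (2 ^ N - 1) := by
  induction N with
  | zero => simp
  | succ N ih => rw [Finset.sum_range_succ, ih]; unfold epochLen; ring

theorem cast_epochEnd (d i : ℕ) : (epochEnd d i : ℝ) = d * (2 ^ i - 1) := by
  unfold epochEnd
  rw [Nat.cast_mul, Nat.cast_sub Nat.one_le_two_pow]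
  simp

theorem delta_pos (hd : 0 < d) (hT : 0 < T) (i : ℕ) : 0 < delta d T i := by
  have h1 : (0 : ℝ) < d := by exact_mod_cast hd
  have h2 : (0 : ℝ) < T := by exact_mod_cast hT
  have := epochLen_pos hd i
  exact lt_min (by positivity) one_pos

theorem delta_le_one (d T i : ℕ) : delta d T i ≤ 1 := min_le_right _ _

theorem mul_delta_le (hT : 0 < T) (i : ℕ) : T * delta d T i ≤ d * epochLen d i := by
  have h2 : (0 : ℝ) < T := by exact_mod_cast hT
  calc T * delta d T i ≤ T * (d * epochLen d i / T) :=
        mul_le_mul_of_nonneg_left (min_le_left _ _) h2.le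
    _ = d * epochLen d i := by field_simp

theorem delta_mono (d T : ℕ) : Monotone (delta d T) := fun i j h => by
  unfold delta epochLen
  gcongr
  norm_num

theorem log_inv_delta_nonneg (hd : 0 < d) (hT : 0 < T) (i : ℕ) :
    0 ≤ Real.log (1 / delta d T i) := by
  apply Real.log_nonneg
  rw [le_div_iff₀ (delta_pos hd hT i), one_mul]
  exact delta_le_one d T i

theorem log_inv_delta_antitone (hd : 0 < d) (hT : 0 < T) :
    Antitone fun i => Real.log (1 / delta d T i) := fun i j h => by
  have h1 := delta_pos hd hT i
  have h2 := delta_pos hd hT j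
  exact Real.log_le_log (by positivity) (one_div_le_one_div_of_le h1 (delta_mono d T h))

theorem threshold_sq (hd : 0 < d) (hT : 0 < T) (σ : ℝ) (i : ℕ) :
    threshold d σ (delta d T i) (epochLen d i) ^ 2 = σ ^ 2 * d ^ 2 / epochLen d i *
      (1 + 2 * Real.sqrt (1 / d * Real.log (1 / delta d T i)) +
        2 / d * Real.log (1 / delta d T i)) := by
  have h1 := log_inv_delta_nonneg hd hT i
  have h2 := epochLen_pos hd i
  exact Real.sq_sqrt (by positivity)

theorem threshold_nonneg (d : ℕ) (σ δ n : ℝ) : 0 ≤ threshold d σ δ n := Real.sqrt_nonneg _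

/-- `U²` is `1/n` times a factor that does not increase with the subphase, since `δ_i` grows; `n`
doubles each time. -/
theorem threshold_sq_add_le (hd : 0 < d) (hT : 0 < T) (σ : ℝ) (i k : ℕ) :
    2 ^ k * threshold d σ (delta d T (i + k)) (epochLen d (i + k)) ^ 2 ≤
      threshold d σ (delta d T i) (epochLen d i) ^ 2 := by
  rw [threshold_sq hd hT, threshold_sq hd hT, epochLen_add]
  have h1 := log_inv_delta_nonneg hd hT (i + k)
  have h2 := epochLen_pos hd i
  have h3 : Real.log (1 / delta d T (i + k)) ≤ Real.log (1 / delta d T i) :=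
    log_inv_delta_antitone hd hT (Nat.le_add_right i k)
  have h4 : (2 : ℝ) ^ k * (σ ^ 2 * d ^ 2 / (2 ^ k * epochLen d i) *
      (1 + 2 * Real.sqrt (1 / d * Real.log (1 / delta d T (i + k))) +
        2 / d * Real.log (1 / delta d T (i + k)))) = σ ^ 2 * d ^ 2 / epochLen d i *
      (1 + 2 * Real.sqrt (1 / d * Real.log (1 / delta d T (i + k))) +
        2 / d * Real.log (1 / delta d T (i + k))) := by
    field_simp
  rw [h4]
  gcongr

theorem add_two_mul_log_le (hd : 0 < d) (hT : 0 < T) {σ : ℝ} (hσ : 0 < σ) {i : ℕ} (hi : 1 ≤ i) :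
    d + 2 * Real.log (1 / delta d T i) ≤
      2 ^ (i - 1) * threshold d σ (delta d T i) (epochLen d i) ^ 2 / σ ^ 2 := by
  have h0 : (0 : ℝ) < d := by exact_mod_cast hd
  rw [threshold_sq hd hT, epochLen_eq hi]
  set L := Real.log (1 / delta d T i)
  have h1 : (2 : ℝ) ^ (i - 1) * (σ ^ 2 * d ^ 2 / (d * 2 ^ (i - 1)) *
      (1 + 2 * Real.sqrt (1 / d * L) + 2 / d * L)) / σ ^ 2 =
      d + 2 * L + 2 * d * Real.sqrt (1 / d * L) := by
    field_simp; ring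
  rw [h1]
  have : 0 ≤ 2 * d * Real.sqrt (1 / d * L) := by positivity
  linarith

theorem exists_four_mul_threshold_le (hd : 0 < d) (hT : 0 < T) (σ : ℝ) {b : ℝ} (hb : 0 < b) :
    ∃ i, 1 ≤ i ∧ 4 * threshold d σ (delta d T i) (epochLen d i) ≤ b := by
  set U := fun i => threshold d σ (delta d T i) (epochLen d i) with hU
  obtain ⟨k, hk⟩ := pow_unbounded_of_one_lt (16 * U 1 ^ 2 / b ^ 2) (one_lt_two (α := ℝ))
  refine ⟨1 + k, by omega, ?_⟩
  have h1 := threshold_sq_add_le hd hT σ 1 k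
  have h2 : 16 * U 1 ^ 2 < 2 ^ k * b ^ 2 := by rwa [div_lt_iff₀ (by positivity)] at hk
  have h3 : (2 : ℝ) ^ k * (16 * U (1 + k) ^ 2) < 2 ^ k * b ^ 2 := by simp only [hU] at h2 ⊢; linarith
  have h4 : 16 * U (1 + k) ^ 2 < b ^ 2 := lt_of_mul_lt_mul_left h3 (by positivity)
  have h5 : (4 * U (1 + k)) ^ 2 ≤ b ^ 2 := by nlinarith
  exact le_of_sq_le_sq h5 hb.le

theorem one_le_logBar (x : ℝ) : 1 ≤ logBar x := by
  unfold logBar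
  linarith [Real.log_nonneg (le_max_right x 1)]

/-- The inequality is implicit, since `U` contains `log (1/δ_i)`. Write `Q = σ² d² / b²`. Either
`n_i ≤ 16 Q` already, or `δ_i > 16 d Q / T` when not truncated, which bounds `log (1/δ_i)` by `log
(T/Q) - log 16`. Here `352/10 = 16 · 2.2`. -/
theorem epochLen_le_of_lt_four_mul_threshold (hd : 0 < d) (hT : 0 < T) {σ : ℝ} (hσ : 0 < σ) {b : ℝ}
    (hb : 0 < b) {i : ℕ} (hi : b < 4 * threshold d σ (delta d T i) (epochLen d i)) :
    epochLen d i ≤ 352 / 10 * (σ ^ 2 * d ^ 2 / b ^ 2) * logBar (T * b ^ 2 / (σ ^ 2 * d ^ 2)) := by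
  have hd1 : (1 : ℝ) ≤ d := by exact_mod_cast hd
  have hT0 : (0 : ℝ) < T := by exact_mod_cast hT
  have hU := threshold_sq hd hT σ i
  have hL := log_inv_delta_nonneg hd hT i
  have hp := epochLen_pos hd i
  set p := epochLen d i with hpdef
  set L := Real.log (1 / delta d T i) with hLdef
  set Q := σ ^ 2 * d ^ 2 / b ^ 2 with hQ
  have hQ0 : 0 < Q := by positivity
  have hTQ : T * b ^ 2 / (σ ^ 2 * d ^ 2) = T / Q := by rw [hQ]; field_simp
  rw [hTQ]
  set g := 1 + 2 * Real.sqrt (1 / d * L) + 2 / d * L with hg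
  have h1 : p < 16 * Q * g := by
    have h2 : b ^ 2 < 16 * (σ ^ 2 * d ^ 2 / p * g) := by
      rw [← hU]
      have := pow_lt_pow_left₀ hi hb.le two_ne_zero
      nlinarith
    have h3 : 16 * (σ ^ 2 * d ^ 2 / p * g) = 16 * Q * g * b ^ 2 / p := by rw [hQ]; field_simp
    rw [h3, lt_div_iff₀ hp, mul_comm] at h2
    exact lt_of_mul_lt_mul_right h2 (by positivity)
  have hlb := one_le_logBar (T / Q)
  have key : g ≤ 22 / 10 * logBar (T / Q) ∨ p ≤ 16 * Q := by
    by_cases hpQ : p ≤ 16 * Q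
    · exact Or.inr hpQ
    left
    rw [not_le] at hpQ
    have hgL : g ≤ 1 + 2 * Real.sqrt L + 2 * L := by
      have h2 : 1 / (d : ℝ) ≤ 1 := by rw [div_le_one (by linarith)]; exact hd1
      have h3 : 1 / (d : ℝ) * L ≤ L := mul_le_of_le_one_left hL h2
      have h4 : 2 / (d : ℝ) * L ≤ 2 * L := by
        have : 2 / (d : ℝ) * L = 2 * (1 / d * L) := by ring
        linarith
      have h5 := Real.sqrt_le_sqrt h3
      linarith
    have hs := Real.sq_sqrt hL
    rcases hL.eq_or_lt with h0 | h0
    · rw [← h0] at hgL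
      simp at hgL
      linarith
    · have hδ : delta d T i = d * p / T := by
        rcases min_choice (d * epochLen d i / T : ℝ) 1 with h | h
        · exact h
        · have h' : delta d T i = 1 := h
          rw [hLdef, h'] at h0
          simp at h0
      have h16 : (2 : ℝ) ≤ Real.log 16 := by
        rw [Real.le_log_iff_exp_le (by norm_num)]
        have : Real.exp 2 = Real.exp 1 * Real.exp 1 := by rw [← Real.exp_add]; norm_num
        rw [this]
        nlinarith [Real.exp_one_lt_d9, Real.exp_pos 1]
      have h2 : L ≤ Real.log (T / Q) - 2 := by
        have h3 : L ≤ Real.log (T / Q / 16) := by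
          rw [hLdef, hδ]
          apply Real.log_le_log (by positivity)
          rw [one_div_div, div_div]
          apply div_le_div_of_nonneg_left hT0.le (by positivity)
          nlinarith
        rw [Real.log_div (by positivity) (by norm_num)] at h3
        linarith
      have h3 : 3 + L ≤ logBar (T / Q) := by
        unfold logBar
        have : Real.log (T / Q) ≤ Real.log (max (T / Q) 1) :=
          Real.log_le_log (by positivity) (le_max_left _ _)
        linarith
      -- The gain `log 16 ≥ 2` pays for the constant: `1 + 2 √L + 2 L ≤ 2.2 (3 + L)` follows from
      -- `0.2 (√L - 5)² ≥ 0`.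
      nlinarith [sq_nonneg (Real.sqrt L - 5)]
  rcases key with h | h
  · calc p ≤ 16 * Q * g := h1.le
      _ ≤ 16 * Q * (22 / 10 * logBar (T / Q)) := by gcongr
      _ = _ := by ring
  · nlinarith

end Threshold

/-! ### Numerical bounds for the two failure sums -/

section Numerics

/-- The exponent `(3/8)(81/25) = 1.215` exceeds `log 2` by more than `0.52`, and `d exp (-0.52 d) ≤
1 / (0.52 e)`. -/
theorem mul_two_pow_mul_exp_le (d : ℕ) :
    d * (2 ^ d * Real.exp (-(3 / 8 * (81 / 25) * d))) ≤ 71 / 100 := by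
  have h1 : (2 : ℝ) ^ d = Real.exp (d * Real.log 2) := by
    rw [mul_comm, Real.exp_mul, Real.exp_log two_pos, Real.rpow_natCast]
  have h2 := Real.log_two_lt_d9
  rw [h1, ← Real.exp_add]
  have h3 : (d : ℝ) * Real.log 2 + -(3 / 8 * (81 / 25) * d) ≤ -(52 / 100 * d) := by
    have : (0 : ℝ) ≤ d := Nat.cast_nonneg d
    nlinarith
  have h4 : 52 / 100 * (d : ℝ) * Real.exp (-(52 / 100 * d)) ≤ Real.exp (-1) := by
    have := Real.add_one_le_exp (52 / 100 * (d : ℝ) - 1)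
    rw [sub_add_cancel] at this
    calc 52 / 100 * (d : ℝ) * Real.exp (-(52 / 100 * d))
        ≤ Real.exp (52 / 100 * (d : ℝ) - 1) * Real.exp (-(52 / 100 * d)) := by gcongr
      _ = Real.exp (-1) := by rw [← Real.exp_add]; ring_nf
  have h5 := Real.exp_neg_one_lt_d9
  calc (d : ℝ) * Real.exp (d * Real.log 2 + -(3 / 8 * (81 / 25) * d))
      ≤ d * Real.exp (-(52 / 100 * d)) := by gcongr
    _ ≤ 71 / 100 := by linarith

theorem natCast_mul_pow_le {x : ℝ} (h0 : 0 ≤ x) (hx : x ≤ 1 / 2) (d : ℕ) : d * x ^ d ≤ x := by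
  cases d with
  | zero => simpa using h0
  | succ d =>
    have h1 : ((d + 1 : ℕ) : ℝ) ≤ 2 ^ d := by exact_mod_cast Nat.lt_two_pow_self
    have h2 : x ^ d ≤ (1 / 2) ^ d := pow_le_pow_left₀ h0 hx d
    calc ((d + 1 : ℕ) : ℝ) * x ^ (d + 1) = ((d + 1 : ℕ) : ℝ) * x ^ d * x := by rw [pow_succ]; ring
      _ ≤ 2 ^ d * (1 / 2) ^ d * x := by gcongr
      _ = x := by rw [← mul_pow]; norm_num

/-- With `y` the exponential for `d = 1`, the bound `2^k ≥ k + 1` gives `y ≤ 0.08^(k+1)`; then `d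
(2y)^d ≤ 2y`, and the factor `2^(k+1)` turns `0.08` into `0.16`. -/
theorem mul_two_pow_mul_exp_two_pow_le (d k : ℕ) :
    2 ^ (k + 1) * (d * (2 ^ d * Real.exp (-(3 / 8 * (34596 / 10000 * 2 ^ (k + 1)) * d)))) ≤
      2 * (16 / 100) ^ (k + 1) := by
  set y : ℝ := Real.exp (-(3 / 8 * (34596 / 10000 * 2 ^ (k + 1)))) with hy
  have hpow : Real.exp (-(3 / 8 * (34596 / 10000 * 2 ^ (k + 1)) * d)) = y ^ d := by
    rw [hy, ← Real.exp_nat_mul]; ring_nf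
  have h1 : Real.exp (-(25947 / 10000)) ≤ 8 / 100 := by
    rw [Real.exp_neg, inv_le_comm₀ (Real.exp_pos _) (by norm_num)]
    have h2 : Real.exp (25947 / 10000) = Real.exp 1 * Real.exp 1 * Real.exp (5947 / 10000) := by
      rw [← Real.exp_add, ← Real.exp_add]; norm_num
    have h3 := Real.quadratic_le_exp_of_nonneg (x := 5947 / 10000) (by norm_num)
    have h4 := Real.exp_one_gt_d9
    rw [h2]
    have h5 : (738 / 100 : ℝ) ≤ Real.exp 1 * Real.exp 1 := by nlinarith
    nlinarith
  have h2 : y ≤ (8 / 100) ^ (k + 1) := by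
    have h3 : ((k + 1 : ℕ) : ℝ) ≤ 2 ^ k := by exact_mod_cast Nat.lt_two_pow_self
    calc y ≤ Real.exp ((k + 1 : ℕ) * (-(25947 / 10000))) := by
          rw [hy, Real.exp_le_exp, pow_succ]
          nlinarith
      _ = Real.exp (-(25947 / 10000)) ^ (k + 1) := Real.exp_nat_mul _ _
      _ ≤ (8 / 100) ^ (k + 1) := pow_le_pow_left₀ (Real.exp_pos _).le h1 _
  have hy0 : 0 ≤ y := (Real.exp_pos _).le
  have h3 : y ≤ 8 / 100 := h2.trans (pow_le_of_le_one (by norm_num) (by norm_num) (by omega))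
  rw [hpow, ← mul_pow]
  calc (2 : ℝ) ^ (k + 1) * (d * (2 * y) ^ d) ≤ 2 ^ (k + 1) * (2 * y) :=
        mul_le_mul_of_nonneg_left (natCast_mul_pow_le (by positivity) (by linarith) d)
          (by positivity)
    _ ≤ 2 ^ (k + 1) * (2 * (8 / 100) ^ (k + 1)) := by gcongr
    _ = 2 * (2 * (8 / 100)) ^ (k + 1) := by rw [mul_pow]; ring
    _ = _ := by norm_num

theorem sum_geometric_sixteen_le (K : ℕ) :
    ∑ k ∈ Finset.range K, (16 / 100 : ℝ) ^ (k + 1) ≤ 4 / 21 := by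
  have h : ∑ k ∈ Finset.range K, (16 / 100 : ℝ) ^ (k + 1) = 4 / 21 * (1 - (16 / 100) ^ K) := by
    induction K with
    | zero => simp
    | succ K ih => rw [Finset.sum_range_succ, ih]; ring
  rw [h]
  have : (0 : ℝ) ≤ (16 / 100) ^ K := by positivity
  linarith

end Numerics

/-! ### Tail of the warm-up noise on the scale of the threshold -/

section WarmTail

variable {Ω : Type*} [MeasurableSpace Ω] {μ : Measure Ω} {z : ℕ → Ω → ℝ}

/-- The threshold dominates `d + 2 log (1/δ)` in noise units. For `s ≥ 4/3` the logarithm enters the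
exponent with weight `(3/8) · 2 s ≥ 1` and yields the factor `δ`; the `d` part is left to beat
`2^d`. -/
theorem measureReal_norm_warmNoise_ge_le [IsProbabilityMeasure μ] {d T : ℕ} (hd : 0 < d) (hT : 0 < T)
    (hz : ∀ t, Measurable (z t)) (hindep : iIndepFun z μ) {σ : ℝ} (hσ : 0 < σ)
    (hsub : ∀ t, HasSubgaussianMGF (z t) (⟨σ ^ 2, sq_nonneg σ⟩ : ℝ≥0) μ)
    {i : ℕ} (hi : 1 ≤ i) {r s : ℝ} (hr : 0 ≤ r) (hs : 4 / 3 ≤ s)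
    (h : s * threshold d σ (delta d T i) (epochLen d i) ^ 2 ≤ r ^ 2) :
    μ.real {ω | r ≤ ‖warmNoise d (fun t => z t ω) i‖} ≤
      delta d T i * (2 ^ d * Real.exp (-(3 / 8 * s * d))) := by
  have h1 := measureReal_norm_blockNoise_ge_le (d := d) hz hindep
    (c := ⟨σ ^ 2, sq_nonneg σ⟩) (by exact_mod_cast (by positivity : 0 < σ ^ 2)) hsub
    (2 ^ (i - 1) - 1) (m := 2 ^ (i - 1)) (by positivity) hr
  refine h1.trans ?_
  change 2 ^ d * Real.exp (-(3 / 8 * (((2 ^ (i - 1) : ℕ) : ℝ) * r ^ 2 / σ ^ 2))) ≤ _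
  have h2 := add_two_mul_log_le hd hT hσ hi
  have hL := log_inv_delta_nonneg hd hT i
  have hδ := delta_pos hd hT i
  set L := Real.log (1 / delta d T i) with hLdef
  set U := threshold d σ (delta d T i) (epochLen d i)
  have h3 : s * (d + 2 * L) ≤ ((2 ^ (i - 1) : ℕ) : ℝ) * r ^ 2 / σ ^ 2 := by
    push_cast
    calc s * (d + 2 * L) ≤ s * (2 ^ (i - 1) * U ^ 2 / σ ^ 2) := by gcongr
      _ = 2 ^ (i - 1) * (s * U ^ 2) / σ ^ 2 := by ring
      _ ≤ _ := by gcongr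
  have h4 : delta d T i = Real.exp (-L) := by
    rw [hLdef, one_div, Real.log_inv, neg_neg, Real.exp_log hδ]
  rw [h4, mul_left_comm, ← Real.exp_add]
  gcongr
  nlinarith

end WarmTail

/-! ### How large the noise must be for the warm-up to fail -/

section Geometry

variable {E : Type*} [NormedAddCommGroup E] {v w : E} {U : ℝ}

/-- An overestimate is the binding case: `‖w‖ ≥ (1 - 2/5) ‖v + w‖ > (3/5) · 3 U`. -/
theorem threshold_le_norm_noise_of_exit (hexit : 3 * U < ‖v + w‖)
    (hbad : ¬ (2 / 5 * ‖v‖ ≤ ‖v + w‖ ∧ ‖v + w‖ ≤ 5 / 2 * ‖v‖)) : 9 / 5 * U ≤ ‖w‖ := by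
  have h1 : ‖v + w‖ ≤ ‖v‖ + ‖w‖ := norm_add_le v w
  have h2 : ‖v‖ ≤ ‖v + w‖ + ‖w‖ := by
    simpa using norm_sub_le (v + w) w
  by_contra h
  exact hbad ⟨by linarith, by linarith⟩

theorem norm_le_norm_noise_of_exit
    (hbad : ¬ (2 / 5 * ‖v‖ ≤ ‖v + w‖ ∧ ‖v + w‖ ≤ 5 / 2 * ‖v‖)) : 465 / 1000 * ‖v‖ ≤ ‖w‖ := by
  have h1 : ‖v + w‖ ≤ ‖v‖ + ‖w‖ := norm_add_le v w
  have h2 : ‖v‖ ≤ ‖v + w‖ + ‖w‖ := by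
    simpa using norm_sub_le (v + w) w
  have h3 := norm_nonneg v
  by_contra h
  exact hbad ⟨by linarith, by linarith⟩

/-- One subphase beyond detection, `U ≤ ‖v‖ / (4√2)`, so `3 U ≤ 0.535 ‖v‖` and the noise must supply
the remaining `0.465 ‖v‖`. -/
theorem norm_le_norm_noise_of_not_exit (hexit : ‖v + w‖ ≤ 3 * U)
    (h : 2 * (16 * U ^ 2) ≤ ‖v‖ ^ 2) : 465 / 1000 * ‖v‖ ≤ ‖w‖ := by
  have h2 : ‖v‖ ≤ ‖v + w‖ + ‖w‖ := by
    simpa using norm_sub_le (v + w) w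
  have h3 : 3 * U ≤ 535 / 1000 * ‖v‖ := by
    apply le_of_sq_le_sq _ (by positivity)
    nlinarith [sq_nonneg ‖v‖]
  linarith

end Geometry

/-- Here `x` stands for `√T`. Exploration costs `2b/B` and commitment `2B/b` in units of `d σ √T`;
for `B/b` in `[2/5, 5/2]` the sum is largest at the endpoints, `2 (5/2 + 2/5) = 29/5`. Rounding up
`m` adds `2 b d`. -/
theorem explore_commit_tradeoff {b σ d x B : ℝ} {m : ℕ} (hb : 0 < b) (hσ : 0 < σ) (hd : 0 ≤ d)
    (hx : 0 < x) (hB1 : 2 / 5 * b ≤ B) (hB2 : B ≤ 5 / 2 * b) (hm : m = ⌈σ * x / B⌉₊) :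
    0 < m ∧ 2 * b * d * m + 2 / b * x ^ 2 * (d * (σ ^ 2 / m)) ≤ 29 / 5 * (d * σ * x) + 2 * b * d := by
  have hB : 0 < B := by linarith
  have h1 : σ * x / B ≤ m := by rw [hm]; exact Nat.le_ceil _
  have h2 : (m : ℝ) ≤ σ * x / B + 1 := by rw [hm]; exact (Nat.ceil_lt_add_one (by positivity)).le
  have hm0 : 0 < m := by rw [hm]; exact Nat.ceil_pos.2 (by positivity)
  refine ⟨hm0, ?_⟩
  have hmr : (0 : ℝ) < m := by exact_mod_cast hm0
  have h3 : σ ^ 2 / m ≤ σ * B / x := by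
    rw [div_le_div_iff₀ hmr hx]
    rw [div_le_iff₀ hB] at h1
    nlinarith
  have h4 : 2 / b * x ^ 2 * (d * (σ ^ 2 / m)) ≤ 2 / b * x ^ 2 * (d * (σ * B / x)) := by gcongr
  have h5 : 2 * b * d * m ≤ 2 * b * d * (σ * x / B + 1) := by gcongr
  have h6 : 2 * b * d * (σ * x / B + 1) + 2 / b * x ^ 2 * (d * (σ * B / x)) =
      (2 * b / B + 2 * B / b) * (d * σ * x) + 2 * b * d := by field_simp; ring
  have h7 : 2 * b / B + 2 * B / b ≤ 29 / 5 := by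
    rw [div_add_div _ _ hB.ne' hb.ne', div_le_iff₀ (by positivity)]
    nlinarith [mul_nonneg (sub_nonneg.2 hB1) (sub_nonneg.2 hB2)]
  have h8 : (2 * b / B + 2 * B / b) * (d * σ * x) ≤ 29 / 5 * (d * σ * x) := by gcongr
  linarith

/-! ### Pathwise regret decomposition -/

section Pathwise

variable {d : ℕ} {A : Matrix (Fin d) (Fin d) ℝ} {xs : (Fin d → ℝ) → Fin d → ℝ}
  {σ : ℝ} {T : ℕ} {θ : Fin d → ℝ} {z : ℕ → ℝ}

theorem e2tc_mem_ellipsoid (hA : A.PosDef) (hxs : IsArgmax (ellipsoid A) xs) (σ α : ℝ) (T t : ℕ)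
    (past : Fin t → ℝ) : e2tc A xs σ α T t past ∈ ellipsoid A := by
  unfold e2tc
  dsimp only
  split_ifs
  · exact explore_mem_ellipsoid hA t
  · exact (hxs _).1
  · exact explore_mem_ellipsoid hA t

theorem abs_action_dotProduct_le (hA : A.PosDef) (hxs : IsArgmax (ellipsoid A) xs) (σ α : ℝ)
    (T : ℕ) (θ : Fin d → ℝ) (z : ℕ → ℝ) (t : ℕ) :
    |action (e2tc A xs σ α T) θ z t ⬝ᵥ θ| ≤ ‖whiten A θ‖ :=
  abs_dotProduct_le_of_mem_ellipsoid hA (e2tc_mem_ellipsoid hA hxs σ α T t _) θ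

theorem instant_regret_le (hA : A.PosDef) (hxs : IsArgmax (ellipsoid A) xs) (σ α : ℝ)
    (T : ℕ) (θ : Fin d → ℝ) (z : ℕ → ℝ) (t : ℕ) :
    xs θ ⬝ᵥ θ - action (e2tc A xs σ α T) θ z t ⬝ᵥ θ ≤ 2 * ‖whiten A θ‖ := by
  have h := (abs_le.1 (abs_action_dotProduct_le hA hxs σ α T θ z t)).1
  rw [argmax_self hA hxs]
  linarith

theorem pathRegret_le (hA : A.PosDef) (hxs : IsArgmax (ellipsoid A) xs) (σ α : ℝ)
    (T : ℕ) (θ : Fin d → ℝ) (z : ℕ → ℝ) :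
    pathRegret xs (e2tc A xs σ α T) θ T z ≤ 2 * ‖whiten A θ‖ * T := by
  calc pathRegret xs (e2tc A xs σ α T) θ T z ≤ ∑ _t ∈ Finset.range T, 2 * ‖whiten A θ‖ :=
        Finset.sum_le_sum fun t _ => instant_regret_le hA hxs σ α T θ z t
    _ = _ := by simp [mul_comm]

/-- `i` is the first subphase that meets the exit criterion, and it is followed by `m` round-robin
passes of exploration. -/
def ExitEvent (A : Matrix (Fin d) (Fin d) ℝ) (σ α : ℝ) (T : ℕ) (θ : Fin d → ℝ) (i m : ℕ)
    (z : ℕ → ℝ) : Prop :=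
  FirstExit A σ α T (exploreReward A θ z) i ∧
    ⌈σ * Real.sqrt T / ‖whiten A θ + warmNoise d z i‖⌉₊ = m

theorem ExitEvent.exploreRounds_eq (hA : A.PosDef) {α : ℝ} {i m : ℕ}
    (h : ExitEvent A σ α T θ i m z) : exploreRounds A σ T (exploreReward A θ z) i = d * m := by
  rw [exploreRounds, exploreLen, wnorm_warmEstimate hA θ z h.1.1.1, h.2]

theorem ExitEvent.action_eq (hA : A.PosDef) {α : ℝ} {i m t : ℕ}
    (h : ExitEvent A σ α T θ i m z) (ht : epochEnd d i + d * m ≤ t) :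
    action (e2tc A xs σ α T) θ z t =
      xs (lsOn (Finset.Ico (epochEnd d i) (epochEnd d i + d * m)) (explore A)
        (exploreReward A θ z)) := by
  have h1 := ((action_e2tc A xs σ α T θ z t).2 i (by omega) h.1).2
  rw [h.exploreRounds_eq hA] at h1
  exact h1 ht

theorem ExitEvent.pathRegret_le (hA : A.PosDef) (hxs : IsArgmax (ellipsoid A) xs)
    (hθ : whiten A θ ≠ 0) {α : ℝ} {i m : ℕ} (hm : 0 < m) (h : ExitEvent A σ α T θ i m z) :
    pathRegret xs (e2tc A xs σ α T) θ T z ≤ 2 * ‖whiten A θ‖ * epochEnd d i +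
      (2 * ‖whiten A θ‖ * d * m + 2 / ‖whiten A θ‖ * T * ‖blockNoise d z (2 ^ i - 1) m‖ ^ 2) := by
  set b := ‖whiten A θ‖ with hb
  have hb0 : 0 ≤ b := norm_nonneg _
  set c := 2 / b * ‖blockNoise d z (2 ^ i - 1) m‖ ^ 2 with hc
  have hc0 : 0 ≤ c := by positivity
  have hstep : ∀ t ∈ Finset.range T, xs θ ⬝ᵥ θ - action (e2tc A xs σ α T) θ z t ⬝ᵥ θ ≤
      (if t < epochEnd d i + d * m then 2 * b else 0) + c := by
    intro t _
    split_ifs with ht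
    · linarith [instant_regret_le hA hxs σ α T θ z t]
    · rw [h.action_eq hA (not_lt.1 ht), argmax_self hA hxs, zero_add]
      refine (regret_argmax_le hA hxs _ θ hθ).trans (le_of_eq ?_)
      rw [whiten_lsOn_explore hA θ z i hm, add_sub_cancel_left]
  -- Only an inequality, because the horizon may interrupt warm-up or exploration.
  have hcount : ∑ t ∈ Finset.range T, (if t < epochEnd d i + d * m then 2 * b else 0) ≤
      ((epochEnd d i + d * m : ℕ) : ℝ) * (2 * b) := by
    rw [← Finset.sum_filter, Finset.sum_const, nsmul_eq_mul]
    gcongr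
    calc ((Finset.range T).filter (fun t => t < epochEnd d i + d * m)).card
        ≤ (Finset.range (epochEnd d i + d * m)).card := Finset.card_le_card fun t ht => by
          simpa using (Finset.mem_filter.1 ht).2
      _ = _ := Finset.card_range _
  calc pathRegret xs (e2tc A xs σ α T) θ T z
      ≤ ∑ t ∈ Finset.range T, ((if t < epochEnd d i + d * m then 2 * b else 0) + c) :=
        Finset.sum_le_sum hstep
    _ ≤ ((epochEnd d i + d * m : ℕ) : ℝ) * (2 * b) + T * c := by
        rw [Finset.sum_add_distrib, Finset.sum_const, Finset.card_range, nsmul_eq_mul]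
        gcongr
    _ = _ := by rw [hc]; push_cast; ring

theorem epochEnd_add (d i l : ℕ) :
    (epochEnd d (i + l) : ℝ) = epochEnd d i + ∑ k ∈ Finset.range l, epochLen d (i + k + 1) := by
  induction l with
  | zero => simp
  | succ l ih =>
    rw [Finset.sum_range_succ, ← add_assoc (epochEnd d i : ℝ), ← ih, cast_epochEnd, ← add_assoc,
      cast_epochEnd]
    unfold epochLen
    ring

/-- The numbers of exploration passes that follow a norm estimate within a factor `5/2` of the
truth. -/
noncomputable def accurateRounds (σ b : ℝ) (T : ℕ) : Finset ℕ :=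
  open Classical in
  (Finset.range (⌈σ * Real.sqrt T / (2 / 5 * b)⌉₊ + 1)).filter fun m =>
    ∃ B, 2 / 5 * b ≤ B ∧ B ≤ 5 / 2 * b ∧ m = ⌈σ * Real.sqrt T / B⌉₊

theorem mem_accurateRounds {b B : ℝ} (hb : 0 < b) (hσ : 0 < σ) (h1 : 2 / 5 * b ≤ B)
    (h2 : B ≤ 5 / 2 * b) : ⌈σ * Real.sqrt T / B⌉₊ ∈ accurateRounds σ b T := by
  classical
  unfold accurateRounds
  rw [Finset.mem_filter, Finset.mem_range, Nat.lt_succ_iff]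
  exact ⟨Nat.ceil_mono (by gcongr), B, h1, h2, rfl⟩

-- Each way of failing is charged to an indicator of large noise in one subphase. A bad exit pays `2
-- b T`, the whole horizon; a missed exit after `i₀` pays for the next, doubled subphase. The late
-- indicators carry both costs. A good exit is charged to its own pair `(i, m)`, so that `m` is
-- deterministic in each summand.
open Classical in
theorem pathRegret_le_sum (hA : A.PosDef) (hxs : IsArgmax (ellipsoid A) xs)
    (hσ : 0 < σ) (hd : 0 < d) (hT : 0 < T) (hθ : whiten A θ ≠ 0) {i₀ K : ℕ}
    (hi₀ : 4 * threshold d σ (delta d T i₀) (epochLen d i₀) ≤ ‖whiten A θ‖)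
    (hK : T ≤ epochEnd d (i₀ + K)) :
    pathRegret xs (e2tc A xs σ 3 T) θ T z ≤ 2 * ‖whiten A θ‖ * epochEnd d (i₀ + 1) +
      ∑ i ∈ Finset.range i₀, (if 9 / 5 * threshold d σ (delta d T (i + 1)) (epochLen d (i + 1)) ≤
        ‖warmNoise d z (i + 1)‖ then 2 * ‖whiten A θ‖ * T else 0) +
      ∑ k ∈ Finset.range K, (if 465 / 1000 * ‖whiten A θ‖ ≤ ‖warmNoise d z (i₀ + 1 + k)‖ then
        2 * ‖whiten A θ‖ * (T + epochLen d (i₀ + 1 + k + 1)) else 0) +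
      ∑ p ∈ Finset.range (i₀ + K + 1) ×ˢ accurateRounds σ ‖whiten A θ‖ T,
        (if ExitEvent A σ 3 T θ p.1 p.2 z then 2 * ‖whiten A θ‖ * d * p.2 +
          2 / ‖whiten A θ‖ * T * ‖blockNoise d z (2 ^ p.1 - 1) p.2‖ ^ 2 else 0) := by
  set v := whiten A θ with hv
  set b := ‖v‖ with hb
  have hb0 : 0 < b := norm_pos_iff.2 hθ
  set y := exploreReward A θ z with hy
  set U := fun i => threshold d σ (delta d T i) (epochLen d i) with hU
  have hU0 : ∀ i, 0 ≤ U i := fun i => threshold_nonneg _ _ _ _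
  set W := fun i => warmNoise d z i with hW
  set ind1 : ℕ → ℝ := fun i => if 9 / 5 * U (i + 1) ≤ ‖W (i + 1)‖ then 2 * b * T else 0 with hind1
  set ind2 : ℕ → ℝ := fun k => if 465 / 1000 * b ≤ ‖W (i₀ + 1 + k)‖ then
    2 * b * (T + epochLen d (i₀ + 1 + k + 1)) else 0 with hind2
  set ind3 : ℕ × ℕ → ℝ := fun p => if ExitEvent A σ 3 T θ p.1 p.2 z then 2 * b * d * p.2 +
    2 / b * T * ‖blockNoise d z (2 ^ p.1 - 1) p.2‖ ^ 2 else 0 with hind3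
  change _ ≤ 2 * b * epochEnd d (i₀ + 1) + ∑ i ∈ Finset.range i₀, ind1 i +
    ∑ k ∈ Finset.range K, ind2 k +
    ∑ p ∈ Finset.range (i₀ + K + 1) ×ˢ accurateRounds σ b T, ind3 p
  have h1nn : ∀ i, 0 ≤ ind1 i := fun i => by simp only [hind1]; split_ifs <;> positivity
  have h2nn : ∀ i, 0 ≤ ind2 i := fun i => by
    have := (epochLen_pos hd (i₀ + 1 + i + 1)).le
    simp only [hind2]; split_ifs <;> positivity
  have h3nn : ∀ i, 0 ≤ ind3 i := fun i => by simp only [hind3]; split_ifs <;> positivity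
  have hs1 : 0 ≤ ∑ i ∈ Finset.range i₀, ind1 i := Finset.sum_nonneg fun i _ => h1nn i
  have hs3 : 0 ≤ ∑ p ∈ Finset.range (i₀ + K + 1) ×ˢ accurateRounds σ b T, ind3 p :=
    Finset.sum_nonneg fun i _ => h3nn i
  have hexit : ∀ i, ExitAt A σ 3 T y i ↔ 1 ≤ i ∧ 3 * U i < ‖v + W i‖ := exitAt_iff hA σ 3 T θ z
  have hnoexit : ∀ k, ¬ ExitAt A σ 3 T y (i₀ + 1 + k) → 465 / 1000 * b ≤ ‖W (i₀ + 1 + k)‖ := by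
    intro k hk
    rw [hexit, not_and, not_lt] at hk
    refine norm_le_norm_noise_of_not_exit (hk (by omega)) ?_
    have h1 := threshold_sq_add_le hd hT σ i₀ (1 + k)
    rw [← add_assoc] at h1
    change 2 ^ (1 + k) * U (i₀ + 1 + k) ^ 2 ≤ U i₀ ^ 2 at h1
    have h2 : (2 : ℝ) ≤ 2 ^ (1 + k) := by
      rw [pow_add, pow_one]; nlinarith [one_le_pow₀ (one_le_two (α := ℝ)) (n := k)]
    have h3 := pow_le_pow_left₀ (by have := hU0 i₀; positivity) hi₀ 2
    change (4 * U i₀) ^ 2 ≤ b ^ 2 at h3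
    nlinarith [sq_nonneg (U (i₀ + 1 + k))]
  -- the warm-up up to a subphase `j` before which no exit took place
  have hwarm : ∀ (j : ℕ), j ≤ i₀ + 1 + K → (∀ i < j, ¬ ExitAt A σ 3 T y i) →
      2 * b * epochEnd d j ≤ 2 * b * epochEnd d (i₀ + 1) +
        ∑ k ∈ Finset.range (j - (i₀ + 1)), ind2 k := by
    intro j hj hno
    rcases le_total j (i₀ + 1) with h | h
    · rw [Nat.sub_eq_zero_of_le h, Finset.sum_range_zero, add_zero]
      have : (epochEnd d j : ℝ) ≤ epochEnd d (i₀ + 1) := by exact_mod_cast epochEnd_mono d h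
      gcongr
    · obtain ⟨l, rfl⟩ : ∃ l, j = i₀ + 1 + l := ⟨j - (i₀ + 1), by omega⟩
      rw [Nat.add_sub_cancel_left, epochEnd_add d (i₀ + 1) l, mul_add, Finset.mul_sum]
      gcongr with k hk
      have hk' := Finset.mem_range.1 hk
      have hle : ind2 k = 2 * b * (T + epochLen d (i₀ + 1 + k + 1)) :=
        if_pos (hnoexit k (hno _ (by omega)))
      rw [hle]
      gcongr
      linarith [Nat.cast_nonneg (α := ℝ) T]
  have hsub : ∀ (j : ℕ), j ≤ i₀ + 1 + K → ∑ k ∈ Finset.range (j - (i₀ + 1)), ind2 k ≤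
      ∑ k ∈ Finset.range K, ind2 k := fun j hj =>
    Finset.sum_le_sum_of_subset_of_nonneg (Finset.range_subset_range.2 (by omega))
      fun k _ _ => h2nn k
  by_cases hex : ∃ i ≤ i₀ + K, ExitAt A σ 3 T y i
  · obtain ⟨i, hi, hiE⟩ := hex
    obtain ⟨τ, hτi, hF⟩ := exists_firstExit hiE
    have hτ : τ ≤ i₀ + K := hτi.trans hi
    have hw := hwarm τ (by omega) hF.2
    have hτE := (hexit τ).1 hF.1
    by_cases hgood : 2 / 5 * b ≤ ‖v + W τ‖ ∧ ‖v + W τ‖ ≤ 5 / 2 * b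
    · set m := ⌈σ * Real.sqrt T / ‖v + W τ‖⌉₊ with hm
      have hE : ExitEvent A σ 3 T θ τ m z := ⟨hF, rfl⟩
      have hm0 : 0 < m := Nat.ceil_pos.2 (by
        have : 0 < ‖v + W τ‖ := lt_of_lt_of_le (by positivity) hgood.1
        positivity)
      have h1 := hE.pathRegret_le hA hxs hθ hm0
      have h2 : ind3 (τ, m) ≤ ∑ p ∈ Finset.range (i₀ + K + 1) ×ˢ accurateRounds σ b T, ind3 p :=
        Finset.single_le_sum (fun p _ => h3nn p) (Finset.mem_product.2
          ⟨Finset.mem_range.2 (by omega), mem_accurateRounds hb0 hσ hgood.1 hgood.2⟩)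
      have h3 : ind3 (τ, m) = 2 * b * d * m +
          2 / b * T * ‖blockNoise d z (2 ^ τ - 1) m‖ ^ 2 := if_pos hE
      have h4 := hsub τ (by omega)
      linarith
    · have h1 := pathRegret_le hA hxs σ 3 T θ z
      have hT2 : 2 * b * T ≤ ∑ i ∈ Finset.range i₀, ind1 i + ∑ k ∈ Finset.range K, ind2 k := by
        have hs2 : 0 ≤ ∑ k ∈ Finset.range K, ind2 k := Finset.sum_nonneg fun i _ => h2nn i
        rcases le_or_gt τ i₀ with h | h
        · obtain ⟨j, rfl⟩ : ∃ j, τ = j + 1 := ⟨τ - 1, by omega⟩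
          have h2 : ind1 j = 2 * b * T :=
            if_pos (threshold_le_norm_noise_of_exit hτE.2 hgood)
          have h3 : ind1 j ≤ ∑ i ∈ Finset.range i₀, ind1 i :=
            Finset.single_le_sum (fun p _ => h1nn p) (Finset.mem_range.2 (by omega))
          linarith
        · obtain ⟨k, rfl⟩ : ∃ k, τ = i₀ + 1 + k := ⟨τ - (i₀ + 1), by omega⟩
          have h2 : ind2 k = 2 * b * (T + epochLen d (i₀ + 1 + k + 1)) :=
            if_pos (norm_le_norm_noise_of_exit hgood)
          have h3 : ind2 k ≤ ∑ i ∈ Finset.range K, ind2 i :=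
            Finset.single_le_sum (fun p _ => h2nn p) (Finset.mem_range.2 (by omega))
          have := (epochLen_pos hd (i₀ + 1 + k + 1)).le
          have : 0 ≤ 2 * b * epochLen d (i₀ + 1 + k + 1) := by positivity
          linarith
      have : 0 ≤ 2 * b * epochEnd d (i₀ + 1) := by positivity
      change _ ≤ 2 * b * T at h1
      linarith
  -- Without an exit the warm-up fills the horizon, so `T` is covered by the subphase lengths
  -- already charged.
  · push Not at hex
    have hw := hwarm (i₀ + 1 + K) le_rfl fun i hi => hex i (by omega)
    have h1 := pathRegret_le hA hxs σ 3 T θ z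
    have h2 : (T : ℝ) ≤ epochEnd d (i₀ + 1 + K) := by
      exact_mod_cast hK.trans (epochEnd_mono d (by omega))
    have h3 := hsub (i₀ + 1 + K) le_rfl
    have h4 : 2 * b * T ≤ 2 * b * epochEnd d (i₀ + 1 + K) := by gcongr
    change _ ≤ 2 * b * T at h1
    linarith

end Pathwise

/-! ### Measurability of exit events and integrability of the regret -/

section Measurability

variable {d : ℕ} {A : Matrix (Fin d) (Fin d) ℝ} {Ω : Type*} [MeasurableSpace Ω] {z : ℕ → Ω → ℝ}

theorem measurable_of_countable_cover {ι β : Type*} [Countable ι] [MeasurableSpace β] {f : Ω → β}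
    (C : ι → Set Ω) (g : ι → Ω → β) (hC : ∀ i, MeasurableSet (C i)) (hcover : ∀ ω, ∃ i, ω ∈ C i)
    (hg : ∀ i, Measurable (g i)) (h : ∀ i, ∀ ω ∈ C i, f ω = g i ω) : Measurable f := by
  intro B hB
  have : f ⁻¹' B = ⋃ i, C i ∩ g i ⁻¹' B := by
    ext ω
    simp only [Set.mem_preimage, Set.mem_iUnion, Set.mem_inter_iff]
    constructor
    · intro hω
      obtain ⟨i, hi⟩ := hcover ω
      exact ⟨i, hi, h i ω hi ▸ hω⟩
    · rintro ⟨i, hi, hω⟩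
      exact (h i ω hi).symm ▸ hω
  rw [this]
  exact MeasurableSet.iUnion fun i => (hC i).inter (hg i hB)

theorem measurable_warmNoise {i : ℕ} (hi : 1 ≤ i) (hz : ∀ t < epochEnd d i, Measurable (z t)) :
    Measurable fun ω => warmNoise d (fun t => z t ω) i := by
  refine measurable_blockNoise fun t ht => hz t ((Finset.mem_Ico.1 ht).2.trans_le (le_of_eq ?_))
  unfold epochEnd
  obtain ⟨k, rfl⟩ : ∃ k, i = k + 1 := ⟨i - 1, by omega⟩
  have : 0 < 2 ^ k := by positivity
  congr 1
  rw [Nat.add_sub_cancel]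
  omega

theorem measurableSet_exitAt (hA : A.PosDef) (σ α : ℝ) (T : ℕ) (θ : Fin d → ℝ) {i : ℕ}
    (hz : ∀ t < epochEnd d i, Measurable (z t)) :
    MeasurableSet {ω | ExitAt A σ α T (exploreReward A θ fun t => z t ω) i} := by
  simp_rw [exitAt_iff hA]
  by_cases hi : 1 ≤ i
  · simp only [hi, true_and]
    exact measurableSet_lt measurable_const ((measurable_warmNoise hi hz).const_add _).norm
  · simp [hi]

theorem measurableSet_firstExit (hA : A.PosDef) (σ α : ℝ) (T : ℕ) (θ : Fin d → ℝ) {i : ℕ}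
    (hz : ∀ t < epochEnd d i, Measurable (z t)) :
    MeasurableSet {ω | FirstExit A σ α T (exploreReward A θ fun t => z t ω) i} := by
  unfold FirstExit
  refine (measurableSet_exitAt hA σ α T θ hz).inter ?_
  have : {ω | ∀ j < i, ¬ ExitAt A σ α T (exploreReward A θ fun t => z t ω) j} =
      ⋂ j, ⋂ (_ : j < i), {ω | ExitAt A σ α T (exploreReward A θ fun t => z t ω) j}ᶜ := by
    ext ω; simp
  change MeasurableSet {ω | ∀ j < i, ¬ ExitAt A σ α T (exploreReward A θ fun t => z t ω) j}
  rw [this]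
  exact MeasurableSet.iInter fun j => MeasurableSet.iInter fun hj =>
    (measurableSet_exitAt hA σ α T θ fun t ht =>
      hz t (ht.trans_le (epochEnd_mono d hj.le))).compl

theorem measurableSet_exitEvent (hA : A.PosDef) (σ α : ℝ) (T : ℕ) (θ : Fin d → ℝ) (i m : ℕ)
    (hz : ∀ t < epochEnd d i, Measurable (z t)) :
    MeasurableSet {ω | ExitEvent A σ α T θ i m fun t => z t ω} := by
  by_cases hi : 1 ≤ i
  · refine (measurableSet_firstExit hA σ α T θ hz).inter ?_
    have h1 : Measurable fun ω =>
        ⌈σ * Real.sqrt T / ‖whiten A θ + warmNoise d (fun t => z t ω) i‖⌉₊ :=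
      Nat.measurable_ceil.comp
        (measurable_const.div ((measurable_warmNoise hi hz).const_add _).norm)
    exact h1 (measurableSet_singleton m)
  · have : {ω | ExitEvent A σ α T θ i m fun t => z t ω} = ∅ := by
      rw [Set.eq_empty_iff_forall_notMem]
      intro ω h
      exact hi h.1.1.1
    rw [this]
    exact MeasurableSet.empty

-- Measurability is asked of `z` only before `epochEnd d i`, so the statement also applies to the
-- σ-algebra generated by these rounds alone, as independence requires.
open Classical in
theorem measurable_exitEvent_indicator (hA : A.PosDef) (σ α : ℝ) (T : ℕ) (θ : Fin d → ℝ) (i m : ℕ)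
    (hz : ∀ t < epochEnd d i, Measurable (z t)) :
    Measurable fun ω => if ExitEvent A σ α T θ i m (fun t => z t ω) then (1 : ℝ) else 0 :=
  Measurable.ite (measurableSet_exitEvent hA σ α T θ i m hz) measurable_const measurable_const

/-- The selector `xs` is arbitrary, but the maximiser is unique for `u ≠ 0` and given by a formula;
at `u = 0` its value is a constant. -/
theorem measurable_argmax_dotProduct (hA : A.PosDef) {xs : (Fin d → ℝ) → Fin d → ℝ}
    (hxs : IsArgmax (ellipsoid A) xs) (θ : Fin d → ℝ) {u : Ω → Fin d → ℝ}
    (hu : Measurable fun ω => whiten A (u ω)) : Measurable fun ω => xs (u ω) ⬝ᵥ θ := by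
  classical
  have h : ∀ ω, xs (u ω) ⬝ᵥ θ = if whiten A (u ω) = 0 then xs 0 ⬝ᵥ θ else
      inner ℝ (whiten A (u ω)) (whiten A θ) / ‖whiten A (u ω)‖ := by
    intro ω
    split_ifs with h0
    · have : CFC.sqrt A *ᵥ u ω = 0 := congrArg WithLp.ofLp h0
      have h1 : u ω = 0 := by
        have h2 := congrArg ((CFC.sqrt A)⁻¹ *ᵥ ·) this
        simpa [Matrix.mulVec_mulVec, Matrix.nonsing_inv_mul _ (isUnit_det_sqrt hA)] using h2
      rw [h1]
    · exact argmax_dotProduct hA hxs _ θ h0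
  simp_rw [h]
  refine Measurable.ite (hu (measurableSet_singleton 0)) measurable_const ?_
  exact (hu.inner measurable_const).div hu.norm

theorem ExitEvent.pos {σ : ℝ} {T : ℕ} {θ : Fin d → ℝ} {i m : ℕ} {z : ℕ → ℝ} (hA : A.PosDef)
    (hσ : 0 < σ) (hT : 0 < T) (h : ExitEvent A σ 3 T θ i m z) : 0 < m := by
  have h1 := ((exitAt_iff hA σ 3 T θ z i).1 h.1.1).2
  have h2 : 0 < ‖whiten A θ + warmNoise d z i‖ :=
    lt_of_le_of_lt (mul_nonneg (by norm_num) (threshold_nonneg _ _ _ _)) h1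
  rw [← h.2]
  exact Nat.ceil_pos.2 (by positivity)

theorem measurable_action_dotProduct (hA : A.PosDef) {xs : (Fin d → ℝ) → Fin d → ℝ}
    (hxs : IsArgmax (ellipsoid A) xs) {σ : ℝ} (hσ : 0 < σ) {T : ℕ} (hT : 0 < T) (θ : Fin d → ℝ)
    (hz : ∀ t, Measurable (z t)) (t : ℕ) :
    Measurable fun ω => action (e2tc A xs σ 3 T) θ (fun t => z t ω) t ⬝ᵥ θ := by
  classical
  let C : Option (ℕ × ℕ) → Set Ω := fun o => o.elim
    {ω | ∀ i, epochEnd d i ≤ t → ¬ ExitAt A σ 3 T (exploreReward A θ fun t => z t ω) i}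
    fun p => {ω | epochEnd d p.1 ≤ t ∧ ExitEvent A σ 3 T θ p.1 p.2 fun t => z t ω}
  let u : ℕ × ℕ → Ω → Fin d → ℝ := fun p ω =>
    lsOn (Finset.Ico (epochEnd d p.1) (epochEnd d p.1 + d * p.2)) (explore A)
      (exploreReward A θ fun t => z t ω)
  -- The value for `m = 0` is a dummy: `whiten_lsOn_explore` needs `0 < m`, and `ExitEvent.pos`
  -- shows that no path has `m = 0`.
  let g : Option (ℕ × ℕ) → Ω → ℝ := fun o => o.elim (fun _ => explore A t ⬝ᵥ θ)
    fun p ω => if p.2 = 0 ∨ t < epochEnd d p.1 + d * p.2 then explore A t ⬝ᵥ θ else xs (u p ω) ⬝ᵥ θ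
  refine measurable_of_countable_cover C g ?_ ?_ ?_ ?_
  · rintro (_ | ⟨i, m⟩)
    · have : C none = ⋂ i, ⋂ (_ : epochEnd d i ≤ t),
          {ω | ExitAt A σ 3 T (exploreReward A θ fun t => z t ω) i}ᶜ := by
        ext ω; simp [C]
      rw [this]
      exact MeasurableSet.iInter fun i => MeasurableSet.iInter fun _ =>
        (measurableSet_exitAt hA σ 3 T θ fun t _ => hz t).compl
    · exact (MeasurableSet.const _).inter (measurableSet_exitEvent hA σ 3 T θ i m fun t _ => hz t)
  · intro ω
    by_cases h : ∃ i, epochEnd d i ≤ t ∧ ExitAt A σ 3 T (exploreReward A θ fun t => z t ω) i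
    · obtain ⟨i, hi, hE⟩ := h
      obtain ⟨τ, hτ, hF⟩ := exists_firstExit hE
      exact ⟨some (τ, ⌈σ * Real.sqrt T / ‖whiten A θ + warmNoise d (fun t => z t ω) τ‖⌉₊),
        (epochEnd_mono d hτ).trans hi, hF, rfl⟩
    · exact ⟨none, fun i hi hE => h ⟨i, hi, hE⟩⟩
  · rintro (_ | ⟨i, m⟩)
    · exact measurable_const
    · change Measurable fun ω => if m = 0 ∨ t < epochEnd d i + d * m then explore A t ⬝ᵥ θ
        else xs (u (i, m) ω) ⬝ᵥ θ
      by_cases hc : m = 0 ∨ t < epochEnd d i + d * m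
      · simp only [if_pos hc]
        exact measurable_const
      · simp only [if_neg hc]
        apply measurable_argmax_dotProduct hA hxs
        have hm : 0 < m := by omega
        simp only [u, whiten_lsOn_explore hA θ _ i hm]
        exact (measurable_blockNoise fun t _ => hz t).const_add _
  · rintro (_ | ⟨i, m⟩) ω hω
    · exact congrArg (· ⬝ᵥ θ) ((action_e2tc A xs σ 3 T θ (fun t => z t ω) t).1 hω)
    · obtain ⟨hi, hE⟩ := hω
      dsimp only at hi hE
      have hm := hE.pos hA hσ hT
      change _ = if m = 0 ∨ t < epochEnd d i + d * m then explore A t ⬝ᵥ θ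
        else xs (u (i, m) ω) ⬝ᵥ θ
      split_ifs with hc
      · have h1 := ((action_e2tc A xs σ 3 T θ (fun t => z t ω) t).2 i hi hE.1).1
        rw [hE.exploreRounds_eq hA] at h1
        rw [h1 (by omega)]
      · rw [hE.action_eq hA (by omega)]

theorem integrable_pathRegret (hA : A.PosDef) {xs : (Fin d → ℝ) → Fin d → ℝ}
    (hxs : IsArgmax (ellipsoid A) xs) {σ : ℝ} (hσ : 0 < σ) {T : ℕ} (hT : 0 < T) (θ : Fin d → ℝ)
    (hz : ∀ t, Measurable (z t)) {μ : Measure Ω} [IsProbabilityMeasure μ] :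
    Integrable (fun ω => pathRegret xs (e2tc A xs σ 3 T) θ T fun t => z t ω) μ := by
  refine integrable_finsetSum _ fun t _ => (integrable_const _).sub ?_
  refine Integrable.of_bound
    (measurable_action_dotProduct hA hxs hσ hT θ hz t).aestronglyMeasurable ‖whiten A θ‖ ?_
  exact Filter.Eventually.of_forall fun ω => abs_action_dotProduct_le hA hxs σ 3 T θ _ t

end Measurability

/-! ### Factorisation of the good-exit cost -/

section Expectation

variable {d : ℕ} {A : Matrix (Fin d) (Fin d) ℝ} {Ω : Type*} [MeasurableSpace Ω] {z : ℕ → Ω → ℝ}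
  {μ : Measure Ω} [IsProbabilityMeasure μ]

theorem integral_ite_const {p : Ω → Prop} [DecidablePred p] (hp : MeasurableSet {ω | p ω}) (c : ℝ) :
    Integrable (fun ω => if p ω then c else 0) μ ∧
      ∫ ω, (if p ω then c else 0) ∂μ = μ.real {ω | p ω} * c := by
  have h : (fun ω => if p ω then c else 0) = {ω | p ω}.indicator fun _ => c := by
    ext ω; simp [Set.indicator_apply]
  rw [h]
  exact ⟨(integrable_const c).indicator hp, by rw [integral_indicator_const c hp, smul_eq_mul]⟩

-- For fixed `(i, m)` the event is decided before round `epochEnd d i`, and the exploration noise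
-- lives from that round on. Independence lets the mean squared error be computed as if there were
-- no conditioning.
open Classical in
theorem integral_exitEvent_le (hA : A.PosDef) (hz : ∀ t, Measurable (z t)) (hindep : iIndepFun z μ)
    {c : ℝ≥0} (hsub : ∀ t, HasSubgaussianMGF (z t) c μ) (σ α : ℝ) (T : ℕ) (θ : Fin d → ℝ) (i : ℕ)
    {m : ℕ} (hm : 0 < m) (a : ℝ) {b : ℝ} (hb : 0 ≤ b) :
    Integrable (fun ω => if ExitEvent A σ α T θ i m (fun t => z t ω) then
      a + b * ‖blockNoise d (fun t => z t ω) (2 ^ i - 1) m‖ ^ 2 else 0) μ ∧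
    ∫ ω, (if ExitEvent A σ α T θ i m (fun t => z t ω) then
      a + b * ‖blockNoise d (fun t => z t ω) (2 ^ i - 1) m‖ ^ 2 else 0) ∂μ ≤
      μ.real {ω | ExitEvent A σ α T θ i m fun t => z t ω} * (a + b * (d * (c / m))) := by
  set f : Ω → ℝ := fun ω => if ExitEvent A σ α T θ i m (fun t => z t ω) then 1 else 0 with hf
  set g : Ω → ℝ := fun ω => a + b * ‖blockNoise d (fun t => z t ω) (2 ^ i - 1) m‖ ^ 2 with hg
  have hfg : (fun ω => if ExitEvent A σ α T θ i m (fun t => z t ω) then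
      a + b * ‖blockNoise d (fun t => z t ω) (2 ^ i - 1) m‖ ^ 2 else 0) = fun ω => f ω * g ω := by
    ext ω
    simp only [hf, hg, ite_mul, one_mul, zero_mul]
  have hmeas : MeasurableSet {ω | ExitEvent A σ α T θ i m fun t => z t ω} :=
    measurableSet_exitEvent hA σ α T θ i m fun t _ => hz t
  obtain ⟨hfi, hfv⟩ := integral_ite_const (μ := μ) hmeas 1
  have hgi : Integrable g μ := (integrable_const a).add
    ((integrable_norm_sq_blockNoise hindep hsub _ hm).const_mul b)
  have hind : IndepFun f g μ := by
    refine indepFun_of_noiseSigma hz hindep (S := Set.Iio (epochEnd d i))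
      (S' := Set.Ici (epochEnd d i)) ?_ ?_ ?_
    · rw [Set.disjoint_left]
      intro t h1 h2
      exact (Set.mem_Iio.1 h1).not_ge h2
    · exact @measurable_exitEvent_indicator d A Ω (noiseSigma z (Set.Iio (epochEnd d i))) z hA σ α T
        θ i m fun t ht => measurable_noiseSigma ht
    · have h1 : Measurable[noiseSigma z (Set.Ici (epochEnd d i))] fun ω =>
          blockNoise d (fun t => z t ω) (2 ^ i - 1) m :=
        @measurable_blockNoise Ω z (noiseSigma z (Set.Ici (epochEnd d i))) d (2 ^ i - 1) m
          fun t ht => measurable_noiseSigma (Finset.mem_Ico.1 ht).1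
      exact (by fun_prop : Measurable fun w : EuclideanSpace ℝ (Fin d) => a + b * ‖w‖ ^ 2).comp h1
  rw [hfg]
  refine ⟨hind.integrable_mul hfi hgi, ?_⟩
  have h1 : ∫ ω, f ω * g ω ∂μ = (∫ ω, f ω ∂μ) * ∫ ω, g ω ∂μ :=
    hind.integral_mul_eq_mul_integral hfi.aestronglyMeasurable hgi.aestronglyMeasurable
  rw [h1, hfv, mul_one]
  refine mul_le_mul_of_nonneg_left ?_ measureReal_nonneg
  rw [hg, integral_add (integrable_const a)
    ((integrable_norm_sq_blockNoise hindep hsub _ hm).const_mul b), integral_const_mul]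
  simp only [integral_const, probReal_univ, one_smul]
  gcongr
  exact integral_norm_sq_blockNoise_le hindep hsub _ hm

theorem sum_measureReal_exitEvent_le (hA : A.PosDef) (hz : ∀ t, Measurable (z t)) (σ α : ℝ) (T : ℕ)
    (θ : Fin d → ℝ) (s : Finset (ℕ × ℕ)) :
    ∑ p ∈ s, μ.real {ω | ExitEvent A σ α T θ p.1 p.2 fun t => z t ω} ≤ 1 := by
  rw [← measureReal_biUnion_finset]
  · exact measureReal_le_one
  · intro p _ q _ hpq
    rw [Function.onFun, Set.disjoint_left]
    rintro ω hp hq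
    have h1 : p.1 = q.1 := hp.1.unique hq.1
    refine hpq (Prod.ext h1 ?_)
    have h2 := hp.2
    rw [h1] at h2
    exact h2.symm.trans hq.2
  · exact fun p _ => measurableSet_exitEvent hA σ α T θ p.1 p.2 fun t _ => hz t

end Expectation

/-! ### Summing the costs -/

section Regret

variable {d : ℕ} {A : Matrix (Fin d) (Fin d) ℝ} {Ω : Type*} [MeasurableSpace Ω] {z : ℕ → Ω → ℝ}
  {μ : Measure Ω} [IsProbabilityMeasure μ] {σ : ℝ} {T : ℕ}

theorem sum_early_exit_le (hd : 0 < d) (hT : 0 < T) (hz : ∀ t, Measurable (z t))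
    (hindep : iIndepFun z μ) (hσ : 0 < σ)
    (hsub : ∀ t, HasSubgaussianMGF (z t) (⟨σ ^ 2, sq_nonneg σ⟩ : ℝ≥0) μ) {b : ℝ} (hb : 0 ≤ b)
    (i₀ : ℕ) :
    ∑ i ∈ Finset.range i₀, μ.real {ω | 9 / 5 * threshold d σ (delta d T (i + 1))
      (epochLen d (i + 1)) ≤ ‖warmNoise d (fun t => z t ω) (i + 1)‖} * (2 * b * T) ≤
      284 / 100 * (b * epochLen d i₀) := by
  have hstep : ∀ i ∈ Finset.range i₀, μ.real {ω | 9 / 5 * threshold d σ (delta d T (i + 1))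
      (epochLen d (i + 1)) ≤ ‖warmNoise d (fun t => z t ω) (i + 1)‖} * (2 * b * T) ≤
      142 / 100 * b * epochLen d (i + 1) := by
    intro i _
    have hU := threshold_nonneg d σ (delta d T (i + 1)) (epochLen d (i + 1))
    have hP := measureReal_norm_warmNoise_ge_le hd hT hz hindep hσ hsub (i := i + 1) (by omega)
      (r := 9 / 5 * threshold d σ (delta d T (i + 1)) (epochLen d (i + 1))) (s := 81 / 25)
      (by positivity) (by norm_num) (by ring_nf; rfl)
    have hδ := mul_delta_le (d := d) hT (i + 1)
    have hX := mul_two_pow_mul_exp_le d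
    have hn := epochLen_pos hd (i + 1)
    set X : ℝ := 2 ^ d * Real.exp (-(3 / 8 * (81 / 25) * d))
    have hX0 : 0 ≤ X := by positivity
    calc _ ≤ delta d T (i + 1) * X * (2 * b * T) := by gcongr
      _ = 2 * b * X * (T * delta d T (i + 1)) := by ring
      _ ≤ 2 * b * X * (d * epochLen d (i + 1)) := by gcongr
      _ = 2 * b * epochLen d (i + 1) * (d * X) := by ring
      _ ≤ 2 * b * epochLen d (i + 1) * (71 / 100) := by gcongr
      _ = _ := by ring
  refine (Finset.sum_le_sum hstep).trans ?_
  rw [← Finset.mul_sum, sum_epochLen]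
  have hbd : 0 ≤ b * d := by positivity
  unfold epochLen
  nlinarith

theorem sum_late_exit_le (hd : 0 < d) (hT : 0 < T) (hz : ∀ t, Measurable (z t))
    (hindep : iIndepFun z μ) (hσ : 0 < σ)
    (hsub : ∀ t, HasSubgaussianMGF (z t) (⟨σ ^ 2, sq_nonneg σ⟩ : ℝ≥0) μ) {b : ℝ} (hb : 0 ≤ b)
    {i₀ : ℕ} (hi₀ : 4 * threshold d σ (delta d T i₀) (epochLen d i₀) ≤ b) (K : ℕ) :
    ∑ k ∈ Finset.range K, μ.real {ω | 465 / 1000 * b ≤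
      ‖warmNoise d (fun t => z t ω) (i₀ + 1 + k)‖} * (2 * b * (T + epochLen d (i₀ + 1 + k + 1))) ≤
      16 / 7 * (b * epochLen d i₀) := by
  have hn := epochLen_pos hd i₀
  have hd1 : (1 : ℝ) ≤ d := by exact_mod_cast hd
  have hstep : ∀ k ∈ Finset.range K, μ.real {ω | 465 / 1000 * b ≤
      ‖warmNoise d (fun t => z t ω) (i₀ + 1 + k)‖} * (2 * b * (T + epochLen d (i₀ + 1 + k + 1))) ≤
      12 * (b * epochLen d i₀) * (16 / 100) ^ (k + 1) := by
    intro k _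
    have h2k : (2 : ℝ) ≤ 2 ^ (k + 1) := by
      rw [pow_succ]; nlinarith [one_le_pow₀ (one_le_two (α := ℝ)) (n := k)]
    have hU := threshold_sq_add_le hd hT σ i₀ (k + 1)
    have hi : i₀ + (k + 1) = i₀ + 1 + k := by omega
    have hlen := epochLen_add d i₀ (k + 1)
    have hlen' : epochLen d (i₀ + 1 + k + 1) = 2 * epochLen d (i₀ + 1 + k) := by
      rw [epochLen_add]; ring
    rw [hi] at hU hlen
    have hb2 := pow_le_pow_left₀ (mul_nonneg (by norm_num) (threshold_nonneg _ _ _ _)) hi₀ 2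
    have hP := measureReal_norm_warmNoise_ge_le hd hT hz hindep hσ hsub (i := i₀ + 1 + k) (by omega)
      (r := 465 / 1000 * b) (s := 34596 / 10000 * 2 ^ (k + 1)) (by positivity) (by linarith)
      (by nlinarith)
    have hδ := mul_delta_le (d := d) hT (i₀ + 1 + k)
    have hδ1 := delta_le_one d T (i₀ + 1 + k)
    have hX := mul_two_pow_mul_exp_two_pow_le d k
    have hδ0 := (delta_pos hd hT (i₀ + 1 + k)).le
    have hn' := epochLen_pos hd (i₀ + 1 + k)
    set X : ℝ := 2 ^ d * Real.exp (-(3 / 8 * (34596 / 10000 * 2 ^ (k + 1)) * d))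
    have hX0 : 0 ≤ X := by positivity
    set n := epochLen d (i₀ + 1 + k)
    set δ := delta d T (i₀ + 1 + k)
    -- `T δ ≤ d n` handles the horizon, and `δ ≤ 1 ≤ d` handles the next subphase of length `2 n`.
    have hkey : δ * (T + 2 * n) ≤ 3 * (d * n) := by
      have : n ≤ d * n := le_mul_of_one_le_left hn'.le hd1
      nlinarith
    rw [hlen']
    calc _ ≤ δ * X * (2 * b * (T + 2 * n)) := by gcongr
      _ = 2 * b * X * (δ * (T + 2 * n)) := by ring
      _ ≤ 2 * b * X * (3 * (d * n)) := by gcongr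
      _ = 6 * (b * epochLen d i₀) * (2 ^ (k + 1) * (d * X)) := by rw [hlen]; ring
      _ ≤ 6 * (b * epochLen d i₀) * (2 * (16 / 100) ^ (k + 1)) := by gcongr
      _ = _ := by ring
  refine (Finset.sum_le_sum hstep).trans ?_
  rw [← Finset.mul_sum]
  calc 12 * (b * epochLen d i₀) * ∑ k ∈ Finset.range K, (16 / 100 : ℝ) ^ (k + 1)
      ≤ 12 * (b * epochLen d i₀) * (4 / 21) :=
        mul_le_mul_of_nonneg_left (sum_geometric_sixteen_le K) (by positivity)
    _ = _ := by ring

theorem integral_pathRegret_le (hd : 0 < d) (hA : A.PosDef) (hσ : 0 < σ)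
    {xs : (Fin d → ℝ) → Fin d → ℝ} (hxs : IsArgmax (ellipsoid A) xs)
    (hz : ∀ t, Measurable (z t)) (hindep : iIndepFun z μ)
    (hsub : ∀ t, HasSubgaussianMGF (z t) (⟨σ ^ 2, sq_nonneg σ⟩ : ℝ≥0) μ)
    {θ : Fin d → ℝ} (hθ : whiten A θ ≠ 0) (hT : 0 < T) {i₀ : ℕ}
    (hi₀ : 4 * threshold d σ (delta d T i₀) (epochLen d i₀) ≤ ‖whiten A θ‖) :
    ∫ ω, pathRegret xs (e2tc A xs σ 3 T) θ T (fun t => z t ω) ∂μ ≤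
      29 / 5 * (d * σ * Real.sqrt T) + 2 * ‖whiten A θ‖ * d +
        135 / 10 * (‖whiten A θ‖ * epochLen d i₀) := by
  classical
  set b := ‖whiten A θ‖ with hb
  have hb0 : 0 < b := norm_pos_iff.2 hθ
  have hT' : (0 : ℝ) < T := by exact_mod_cast hT
  -- `T` further subphases always outlast the horizon, which makes all sums finite.
  have hK : T ≤ epochEnd d (i₀ + T) := (Nat.le_add_left T i₀).trans (le_epochEnd hd _)
  have hpath := fun ω => pathRegret_le_sum (z := fun t => z t ω) hA hxs hσ hd hT hθ hi₀ hK
  have hnorm : ∀ (i : ℕ), 1 ≤ i → ∀ r : ℝ,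
      MeasurableSet {ω | r ≤ ‖warmNoise d (fun t => z t ω) i‖} := fun i hi r =>
    measurableSet_le measurable_const (measurable_warmNoise hi fun t _ => hz t).norm
  have hI1 := fun i => integral_ite_const (μ := μ) (hnorm (i + 1) (by omega)
    (9 / 5 * threshold d σ (delta d T (i + 1)) (epochLen d (i + 1)))) (2 * b * T)
  have hI2 := fun k => integral_ite_const (μ := μ) (hnorm (i₀ + 1 + k) (by omega)
    (465 / 1000 * b)) (2 * b * (T + epochLen d (i₀ + 1 + k + 1)))
  have htrade : ∀ m ∈ accurateRounds σ b T, 0 < m ∧ 2 * b * d * m +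
      2 / b * T * (d * (σ ^ 2 / m)) ≤ 29 / 5 * (d * σ * Real.sqrt T) + 2 * b * d := by
    intro m hm
    obtain ⟨-, B, hB1, hB2, hmB⟩ := Finset.mem_filter.1 hm
    have := explore_commit_tradeoff (d := d) hb0 hσ (Nat.cast_nonneg d) (Real.sqrt_pos.2 hT')
      hB1 hB2 hmB
    rwa [Real.sq_sqrt hT'.le] at this
  set P := Finset.range (i₀ + T + 1) ×ˢ accurateRounds σ b T with hP
  have hI3 : ∀ p ∈ P, _ := fun p hp => integral_exitEvent_le hA hz hindep hsub σ 3 T θ p.1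
    (htrade p.2 (Finset.mem_product.1 hp).2).1 (2 * b * d * p.2)
    (b := 2 / b * T) (by positivity)
  have hint1 := integrable_finsetSum (μ := μ) (Finset.range i₀) fun i _ => (hI1 i).1
  have hint2 := integrable_finsetSum (μ := μ) (Finset.range T) fun k _ => (hI2 k).1
  have hint3 := integrable_finsetSum (μ := μ) P fun p hp => (hI3 p hp).1
  have h1 := sum_early_exit_le (μ := μ) hd hT hz hindep hσ hsub hb0.le i₀
  have h2 := sum_late_exit_le (μ := μ) hd hT hz hindep hσ hsub hb0.le hi₀ T
  have h3 : ∑ p ∈ P, ∫ ω, (if ExitEvent A σ 3 T θ p.1 p.2 (fun t => z t ω) then 2 * b * d * p.2 +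
      2 / b * T * ‖blockNoise d (fun t => z t ω) (2 ^ p.1 - 1) p.2‖ ^ 2 else 0) ∂μ ≤
      29 / 5 * (d * σ * Real.sqrt T) + 2 * b * d := by
    calc _ ≤ ∑ p ∈ P, μ.real {ω | ExitEvent A σ 3 T θ p.1 p.2 fun t => z t ω} *
          (29 / 5 * (d * σ * Real.sqrt T) + 2 * b * d) :=
          Finset.sum_le_sum fun p hp => (hI3 p hp).2.trans
            (mul_le_mul_of_nonneg_left (htrade p.2 (Finset.mem_product.1 hp).2).2
              measureReal_nonneg)
      _ ≤ 1 * (29 / 5 * (d * σ * Real.sqrt T) + 2 * b * d) := by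
          rw [← Finset.sum_mul]
          exact mul_le_mul_of_nonneg_right (sum_measureReal_exitEvent_le hA hz σ 3 T θ P)
            (by positivity)
      _ = _ := one_mul _
  have h0 : 2 * b * (epochEnd d (i₀ + 1) : ℝ) ≤ 8 * (b * epochLen d i₀) := by
    rw [cast_epochEnd, epochLen, pow_succ]
    have : 0 ≤ b * d := by positivity
    nlinarith
  have hmono := integral_mono (integrable_pathRegret hA hxs hσ hT θ hz)
    ((((integrable_const (2 * b * (epochEnd d (i₀ + 1) : ℝ))).add hint1).add hint2).add hint3) hpath
  refine hmono.trans ?_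
  have hsplit : ∀ {f g : Ω → ℝ}, Integrable f μ → Integrable g μ →
      ∫ ω, (f + g) ω ∂μ = ∫ ω, f ω ∂μ + ∫ ω, g ω ∂μ := fun hf hg => integral_add hf hg
  rw [hsplit (((integrable_const _).add hint1).add hint2) hint3,
    hsplit ((integrable_const _).add hint1) hint2, hsplit (integrable_const _) hint1,
    integral_finsetSum _ fun i _ => (hI1 i).1, integral_finsetSum _ fun i _ => (hI2 i).1,
    integral_finsetSum _ fun p hp => (hI3 p hp).1]
  simp only [integral_const, probReal_univ, one_smul]
  rw [Finset.sum_congr rfl fun i _ => (hI1 i).2,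
    Finset.sum_congr rfl fun k (_ : k ∈ Finset.range T) => (hI2 k).2]
  have hn := epochLen_pos hd i₀
  have : 0 ≤ b * epochLen d i₀ := by positivity
  -- The multiples of `b n_{i₀}` are `8` (warm-up), `2.84` (early) and `16/7` (late), below `13.5`
  -- in total.
  linarith

/-- Take the least `i ≥ 1` that passes the test. If `i = 1` its length is `d`; otherwise `i - 1`
fails the test, so its length is bounded, and doubling turns `35.2` into `70.4`. -/
theorem exists_detection_epoch (hd : 0 < d) (hT : 0 < T) (hσ : 0 < σ) {b : ℝ} (hb : 0 < b) :
    ∃ i, 4 * threshold d σ (delta d T i) (epochLen d i) ≤ b ∧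
      epochLen d i ≤ d + 704 / 10 * (σ ^ 2 * d ^ 2 / b ^ 2) *
        logBar (T * b ^ 2 / (σ ^ 2 * d ^ 2)) := by
  classical
  have hex := exists_four_mul_threshold_le hd hT σ hb
  refine ⟨Nat.find hex, (Nat.find_spec hex).2, ?_⟩
  have h1 := (Nat.find_spec hex).1
  have hlog := one_le_logBar (T * b ^ 2 / (σ ^ 2 * d ^ 2))
  have hd0 : (0 : ℝ) ≤ d := Nat.cast_nonneg d
  obtain ⟨j, hj⟩ : ∃ j, Nat.find hex = j + 1 := ⟨Nat.find hex - 1, by omega⟩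
  rw [hj]
  rcases Nat.eq_zero_or_pos j with h0 | h0
  · subst h0
    have : epochLen d (0 + 1) = d := by unfold epochLen; ring
    rw [this]
    exact le_add_of_nonneg_right (by positivity)
  · have h2 := Nat.find_min hex (show j < Nat.find hex by omega)
    rw [not_and, not_le] at h2
    have h3 := epochLen_le_of_lt_four_mul_threshold hd hT hσ hb (h2 h0)
    have h4 : epochLen d (j + 1) = 2 * epochLen d j := by rw [epochLen_add]; ring
    rw [h4]
    linarith

end Regret

end LinBandit

theorem theorem3 {d : ℕ} (hd : 0 < d) (A : Matrix (Fin d) (Fin d) ℝ) (hA : A.PosDef)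
    (σ : ℝ) (hσ : 0 < σ)
    (xs : (Fin d → ℝ) → Fin d → ℝ) (hxs : LinBandit.IsArgmax (LinBandit.ellipsoid A) xs)
    {Ω : Type*} [MeasurableSpace Ω] (μ : Measure Ω) [IsProbabilityMeasure μ]
    (z : ℕ → Ω → ℝ) (hz : ∀ t, Measurable (z t)) (hindep : iIndepFun z μ)
    (hsub : ∀ t, HasSubgaussianMGF (z t) (⟨σ ^ 2, sq_nonneg σ⟩ : ℝ≥0) μ)
    (θ : Fin d → ℝ) (T : ℕ) :
    Integrable (fun ω => LinBandit.pathRegret xs (LinBandit.e2tc A xs σ 3 T) θ T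
      (fun t => z t ω)) μ ∧
    ∫ ω, LinBandit.pathRegret xs (LinBandit.e2tc A xs σ 3 T) θ T (fun t => z t ω) ∂μ ≤
      6 * d * σ * Real.sqrt T
      + 984 * σ ^ 2 * d ^ 2 / LinBandit.wnorm A θ *
          LinBandit.logBar (T * LinBandit.wnorm A θ ^ 2 / (σ ^ 2 * d ^ 2))
      + 290 * d * LinBandit.wnorm A θ
      + 2 * T * LinBandit.wnorm A θ *
          Real.exp (min (2 * d / 3 - 2 / 9 * Real.sqrt T * LinBandit.wnorm A θ / σ) 0) := by
  rw [LinBandit.wnorm_eq_norm_whiten hA]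
  set b := ‖LinBandit.whiten A θ‖ with hb
  have hb0 : 0 ≤ b := norm_nonneg _
  set l := LinBandit.logBar (T * b ^ 2 / (σ ^ 2 * d ^ 2)) with hl
  have hl1 : 1 ≤ l := LinBandit.one_le_logBar _
  -- The exponential term enters only through its nonnegativity; the other three terms already
  -- dominate.
  have hexp := Real.exp_pos (min (2 * d / 3 - 2 / 9 * Real.sqrt T * b / σ) 0)
  have hlast : 0 ≤ 2 * T * b * Real.exp (min (2 * d / 3 - 2 / 9 * Real.sqrt T * b / σ) 0) := by
    positivity
  rcases Nat.eq_zero_or_pos T with hT | hT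
  · subst hT
    refine ⟨by simp [LinBandit.pathRegret], ?_⟩
    simp only [LinBandit.pathRegret, Finset.range_zero, Finset.sum_empty, integral_zero]
    positivity
  refine ⟨LinBandit.integrable_pathRegret hA hxs hσ hT θ hz, ?_⟩
  rcases hb0.eq_or_lt with hbz | hbpos
  · calc ∫ ω, LinBandit.pathRegret xs (LinBandit.e2tc A xs σ 3 T) θ T (fun t => z t ω) ∂μ
        ≤ ∫ _ω, (0 : ℝ) ∂μ := by
          refine integral_mono (LinBandit.integrable_pathRegret hA hxs hσ hT θ hz)
            (integrable_const _) fun ω => ?_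
          refine (LinBandit.pathRegret_le hA hxs σ 3 T θ _).trans (le_of_eq ?_)
          rw [← hb, ← hbz]; ring
      _ ≤ _ := by rw [integral_zero]; positivity
  obtain ⟨i, hi, hlen⟩ := LinBandit.exists_detection_epoch hd hT hσ hbpos
  refine (LinBandit.integral_pathRegret_le hd hA hσ hxs hz hindep hsub
    (norm_pos_iff.1 hbpos) hT hi).trans ?_
  rw [← hb]
  have hd0 : (0 : ℝ) ≤ d := Nat.cast_nonneg d
  have h1 : b * LinBandit.epochLen d i ≤ b * d + 704 / 10 * (σ ^ 2 * d ^ 2 / b * l) := by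
    calc b * LinBandit.epochLen d i ≤ b * (d + 704 / 10 * (σ ^ 2 * d ^ 2 / b ^ 2) * l) := by gcongr
      _ = _ := by field_simp
  have h2 : 984 * σ ^ 2 * d ^ 2 / b * l = 984 * (σ ^ 2 * d ^ 2 / b * l) := by ring
  have h3 : 0 ≤ σ ^ 2 * d ^ 2 / b * l := by positivity
  have h4 : 0 ≤ d * σ * Real.sqrt T := by positivity
  have h5 : 0 ≤ b * d := by positivity
  rw [h2]
  -- `13.5 · 70.4 = 950.4 ≤ 984`, `13.5 + 2 ≤ 290` and `29/5 ≤ 6`.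
  nlinarith
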